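/- Let $M$ be a paracompact (Hausdorff) smooth $n$-manifold, $\pi:TM\to M$ its tangent bundle, $\mathcal TM=TM\setminus 0$ the slit tangent bundle, $\gamma$ the vertical lift ($\gamma_u:T_{\pi(u)}M\to T_u(TM)$), $\rho=(\pi,d\pi)$, $J=\gamma\circ\rho$ the vertical endomorphism, $\overline\eta(u)=(u,u)$, $\mathcal C=\gamma\overline\eta$ the Liouville field, $d_Jf=df\circ J$. A $\pi$-vector field is a smooth section over $\mathcal TM$ of the pullback of $TM$ by $\pi$. Let $F:TM\to[0,\infty)$ be a Finsler metric: $F$ is continuous on $TM$, smooth on $\mathcal TM$, positively homogeneous of degree $1$ on the fibres, and with $E=\frac12F^2$ the form $dd_JE$ has maximal rank on $\mathcal TM$, that is, the metric tensor $g$ (the fibrewise second derivative of $E$, $g_{ij}=\partial^2E/\partial y^i\partial y^j$) is non-degenerate. On an open set $U\subset \mathcal TM$, a geodesic spray of a function $L$ is a smooth vector field $G$ on $U$ with $JG=\mathcal C$, $[\mathcal C,G]=G$ and $i_G\,dd_J(\frac12L^2)=-d(\frac12L^2)$. Associated with it are the Barthel connection $\Gamma=[J,G]$ (i.e. $\Gamma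 W=[JW,G]-J[W,G]$), the horizontal and vertical projectors $h=\frac12(I+\Gamma)$, $v=\frac12(I-\Gamma)$, the horizontal map $\beta=(\rho|_{\ker v})^{-1}$, and the Barthel curvature $\Re=-\frac12[h,h]$, where $[\cdot,\cdot]$ is the Frölicher–Nijenhuis bracket of vector $1$-forms; also $N_{\mathbb L}=\frac12[\mathbb L,\mathbb L]$. Let $G$ be the geodesic spray of $F$ on $\mathcal TM$, and let $\overline\varphi$ be a concurrent $\pi$-vector field of $(M,F)$: $\overline\varphi$ vanishes nowhere, and $\nabla_{\beta\overline W}\overline\varphi=-\overline W=D^\circ_{\beta\overline W}\overline\varphi$, $\nabla_{\gamma\overline W}\overline\varphi=0=D^\circ_{\gamma\overline W}\overline\varphi$ for all $\pi$-vector fields $\overline W$, where $\nabla$ is the Cartan connection and $D^\circ$ the Berwald connection of $F$. Put $\Phi=g(\overline\varphi,\overline\eta)$, $p^2=g(\overline\varphi,\overline\varphi)$, $\mathcal D=\{u\in\mathcal TM: F(u)>\Phi(u)\}$, and on $\mathcal D$ $$\widehat F=\frac{F^2}{F-\Phi}.$$ Assume that $F(1+2p^2)-3\Phi\neq0$ on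 $\mathcal D$, and let $\widehat G$ be a geodesic spray of $\widehat F$ on $\mathcal D$, with associated projectors $\widehat h,\widehat v$ and Barthel curvature $\widehat\Re$. Let $$f_1=\frac{F(4\Phi-F)}{F(1+2p^2)-3\Phi},\qquad f_2=\frac{2F^3}{F(1+2p^2)-3\Phi},\qquad \mathbb S=-\tfrac12\left\{f_1\,J+d_Jf_1\otimes\gamma\overline\eta-d_Jf_2\otimes\gamma\overline\varphi\right\}.$$ Then, on $\mathcal D$, $\mathbb S$ is a smooth semi-basic vector $1$-form (i.e. $J\circ\mathbb S=0$ and $\mathbb S\circ J=0$), and $$\widehat h=h+\mathbb S,\qquad \widehat v=v-\mathbb S,\qquad \widehat\Re=\Re-[h,\mathbb S]-N_{\mathbb S}.$$ -/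

import Mathlib

open scoped Manifold ContDiff
open VectorField

namespace FinslerGeom

noncomputable section

/-- The tangent bundle `TM` of an `n`-dimensional manifold `M`; a point `u` is a pair
`(x, y) = (u.proj, u.2)`. -/
abbrev TM (n : ℕ) (M : Type*) [TopologicalSpace M] [ChartedSpace (EuclideanSpace ℝ (Fin n)) M] :
    Type _ :=
  TangentBundle (𝓡 n) M

variable {n : ℕ} {M : Type*} [TopologicalSpace M] [ChartedSpace (EuclideanSpace ℝ (Fin n)) M]
  [IsManifold (𝓡 n) ∞ M]

/-- Vector fields on `TM` (sections of `TTM`, no regularity; only the values on the open subset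
under consideration matter). -/
abbrev VField (n : ℕ) (M : Type*) [TopologicalSpace M]
    [ChartedSpace (EuclideanSpace ℝ (Fin n)) M] [IsManifold (𝓡 n) ∞ M] : Type _ :=
  (u : TM n M) → TangentSpace (𝓡 n).tangent u

/-- `π`-vector fields: sections of the pullback bundle of `TM` along `π : TM → M`
(no regularity). -/
abbrev PiField (n : ℕ) (M : Type*) [TopologicalSpace M]
    [ChartedSpace (EuclideanSpace ℝ (Fin n)) M] [IsManifold (𝓡 n) ∞ M] : Type _ :=
  (u : TM n M) → TangentSpace (𝓡 n) u.proj

/-- The slit tangent bundle. -/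
def slit (n : ℕ) (M : Type*) [TopologicalSpace M]
    [ChartedSpace (EuclideanSpace ℝ (Fin n)) M] [IsManifold (𝓡 n) ∞ M] : Set (TM n M) :=
  {u | u.2 ≠ 0}

/-- Smoothness of a vector field on a subset `U` of `TM`. -/
def VSmooth (U : Set (TM n M)) (W : VField n M) : Prop :=
  ContMDiffOn (𝓡 n).tangent (𝓡 n).tangent.tangent ∞
    (fun u => (⟨u, W u⟩ : TangentBundle (𝓡 n).tangent (TM n M))) U

/-- Smoothness of a `π`-vector field on a subset `U` of `TM`. -/
def PiSmooth (U : Set (TM n M)) (X : PiField n M) : Prop :=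
  ContMDiffOn (𝓡 n).tangent (𝓡 n).tangent ∞ (fun u => (⟨u.proj, X u⟩ : TM n M)) U

/-- The differential `dπ` of the projection; `ρ = (π, dπ)`. -/
def rho (u : TM n M) : TangentSpace (𝓡 n).tangent u →L[ℝ] TangentSpace (𝓡 n) u.proj :=
  mfderiv (𝓡 n).tangent (𝓡 n) (fun p : TM n M => p.proj) u

/-- The natural injection `γ` (vertical lift): the differential at `y` of the inclusion of the
fibre `T_x M` in `TM`. -/
def gam (u : TM n M) : TangentSpace (𝓡 n) u.proj →L[ℝ] TangentSpace (𝓡 n).tangent u :=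
  mfderiv 𝓘(ℝ, EuclideanSpace ℝ (Fin n)) (𝓡 n).tangent
    (fun w : EuclideanSpace ℝ (Fin n) => (⟨u.proj, w⟩ : TM n M)) u.2

/-- The vertical endomorphism `J = γ ∘ ρ`. -/
def J (u : TM n M) : TangentSpace (𝓡 n).tangent u →L[ℝ] TangentSpace (𝓡 n).tangent u :=
  (gam u).comp (rho u)

/-- The vertical vector field `γ X` of a `π`-vector field. -/
def gamF (X : PiField n M) : VField n M := fun u => gam u (X u)

/-- `J W` for a vector field `W`. -/
def JF (W : VField n M) : VField n M := fun u => J u (W u)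

/-- The fundamental `π`-vector field `η(u) = (u, u)`. -/
def eta : PiField n M := fun u => u.2

/-- The Liouville vector field `C = γ η`. -/
def liouville : VField n M := gamF eta

/-- The Lie bracket of vector fields on `TM`. -/
def br (V W : VField n M) : VField n M := mlieBracket (𝓡 n).tangent V W

/-- The differential of a function on `TM`. -/
def dFun (f : TM n M → ℝ) (u : TM n M) : TangentSpace (𝓡 n).tangent u →L[ℝ] ℝ :=
  mfderiv (𝓡 n).tangent 𝓘(ℝ, ℝ) f u

/-- `d_J f = df ∘ J`. -/
def dJ (f : TM n M → ℝ) (u : TM n M) : TangentSpace (𝓡 n).tangent u →L[ℝ] ℝ :=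
  (dFun f u).comp (J u)

/-- The value `(d d_J f)(V, W)` of the exterior derivative of the 1-form `d_J f` on vector fields:
`V (d_J f (W)) - W (d_J f (V)) - d_J f ([V, W])`. -/
def ddJ (f : TM n M → ℝ) (V W : VField n M) (u : TM n M) : ℝ :=
  dFun (fun p => dJ f p (W p)) u (V u) - dFun (fun p => dJ f p (V p)) u (W u)
    - dJ f u (br V W u)

/-- The energy `E = F² / 2`. -/
def energy (F : TM n M → ℝ) (u : TM n M) : ℝ := F u ^ 2 / 2

/-- The metric tensor of `F` at `u = (x, y)`: the second derivative at `y` of the restriction of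
`E` to the fibre `T_x M`, i.e. `g_ij = ∂²E / ∂y^i ∂y^j`. -/
def metric (F : TM n M → ℝ) (u : TM n M) (a b : TangentSpace (𝓡 n) u.proj) : ℝ :=
  fderiv ℝ (fun y : EuclideanSpace ℝ (Fin n) =>
    fderiv ℝ (fun z : EuclideanSpace ℝ (Fin n) => energy F (⟨u.proj, z⟩ : TM n M)) y b) u.2 a

/-- Finsler structures. In fibre coordinates the Hilbert 2-form `d d_J E` has maximal rank exactly
when the metric tensor is non-degenerate. -/
structure IsFinsler (F : TM n M → ℝ) : Prop where
  nonneg : ∀ u, 0 ≤ F u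
  smooth : ContMDiffOn (𝓡 n).tangent 𝓘(ℝ, ℝ) ∞ F (slit n M)
  continuous : Continuous F
  homogeneous : ∀ (u : TM n M) (c : ℝ), 0 < c → F ⟨u.proj, c • u.2⟩ = c * F u
  nondegenerate : ∀ u ∈ slit n M, ∀ a : TangentSpace (𝓡 n) u.proj,
    (∀ b, metric F u a b = 0) → a = 0

/-- `G` is a spray on the open set `U ⊆ TM` and it is the geodesic spray of `F` there:
`i_G d d_J E = - dE`. -/
structure IsGeodesicSpray (U : Set (TM n M)) (F : TM n M → ℝ) (G : VField n M) : Prop where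
  smooth : VSmooth U G
  J_eq : ∀ u ∈ U, J u (G u) = liouville u
  homogeneous : ∀ u ∈ U, br liouville G u = G u
  geodesic : ∀ W, VSmooth U W → ∀ u ∈ U, ddJ (energy F) G W u = - dFun (energy F) u (W u)

/-- The Barthel connection `Γ = [J, G]`, i.e. `Γ W = [J W, G] - J [W, G]`. -/
def barthel (G W : VField n M) : VField n M := fun u => br (JF W) G u - J u (br W G u)

/-- The horizontal projector `h = (I + Γ) / 2`. -/
def hProj (G W : VField n M) : VField n M := fun u => (1 / 2 : ℝ) • (W u + barthel G W u)

/-- The vertical projector `v = (I - Γ) / 2`. -/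
def vProj (G W : VField n M) : VField n M := fun u => (1 / 2 : ℝ) • (W u - barthel G W u)

/-- The Frölicher–Nijenhuis bracket of two vector 1-forms, given as operators on vector fields. -/
def fnBracket (K L : VField n M → VField n M) (W Z : VField n M) : VField n M := fun u =>
  br (K W) (L Z) u + br (L W) (K Z) u + K (L (br W Z)) u + L (K (br W Z)) u
    - K (br (L W) Z) u - K (br W (L Z)) u - L (br (K W) Z) u - L (br W (K Z)) u

/-- The Nijenhuis torsion `N_L = [L, L] / 2`. -/
def nijenhuis (L : VField n M → VField n M) (W Z : VField n M) : VField n M :=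
  fun u => (1 / 2 : ℝ) • fnBracket L L W Z u

/-- The curvature `- [h, h] / 2` of the Barthel connection. -/
def curvature (G W Z : VField n M) : VField n M :=
  fun u => -((1 / 2 : ℝ) • fnBracket (hProj G) (hProj G) W Z u)

/-- The horizontal map `β = (ρ|_H)⁻¹` of the Barthel connection on the slit tangent bundle: `β X`
is the horizontal (`v B = 0`) vector field `B` with `ρ B = X`. -/
def beta (G : VField n M) (X : PiField n M) : VField n M :=
  Classical.epsilon fun B : VField n M =>
    VSmooth (slit n M) B ∧ ∀ u ∈ slit n M, rho u (B u) = X u ∧ vProj G B u = 0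

/-- The vertical part of the Berwald connection, `D°_{γ X} Y = ρ [γ X, β Y]`. -/
def berwaldV (G : VField n M) (X Y : PiField n M) : PiField n M :=
  fun u => rho u (br (gamF X) (beta G Y) u)

/-- The horizontal part of the Berwald connection, `γ D°_{β X} Y = v [β X, γ Y]`. -/
def berwaldH (G : VField n M) (X Y : PiField n M) : PiField n M :=
  fun u => Function.invFun (gam u) (vProj G (br (beta G X) (gamF Y)) u)

/-- The function `g(X, Y)` for `π`-vector fields. -/
def gF (F : TM n M → ℝ) (X Y : PiField n M) : TM n M → ℝ := fun u => metric F u (X u) (Y u)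

/-- The `π`-vector field `ρ W`. -/
def rhoF (W : VField n M) : PiField n M := fun u => rho u (W u)

/-- `D = ∇_{γ X} Y` for the Cartan connection `∇`, which is the connection determined by
`2 g(∇_{γX} Y, Z) = γX · g(Y, Z) + g(Y, ρ[βZ, γX]) + g(Z, ρ[γX, βY])`. -/
def IsCartanV (F : TM n M → ℝ) (G : VField n M) (X Y D : PiField n M) : Prop :=
  ∀ Z, PiSmooth (slit n M) Z → ∀ u ∈ slit n M,
    2 * gF F D Z u = dFun (gF F Y Z) u (gamF X u)
      + gF F Y (rhoF (br (beta G Z) (gamF X))) u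
      + gF F Z (rhoF (br (gamF X) (beta G Y))) u

/-- `D = ∇_{β X} Y` for the Cartan connection `∇`, which is the connection determined by
`2 g(∇_{βX} Y, Z) = βX · g(Y, Z) + βY · g(Z, X) - βZ · g(X, Y)
  - g(X, ρ[βY, βZ]) + g(Y, ρ[βZ, βX]) + g(Z, ρ[βX, βY])`. -/
def IsCartanH (F : TM n M → ℝ) (G : VField n M) (X Y D : PiField n M) : Prop :=
  ∀ Z, PiSmooth (slit n M) Z → ∀ u ∈ slit n M,
    2 * gF F D Z u = dFun (gF F Y Z) u (beta G X u) + dFun (gF F Z X) u (beta G Y u)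
      - dFun (gF F X Y) u (beta G Z u)
      - gF F X (rhoF (br (beta G Y) (beta G Z))) u
      + gF F Y (rhoF (br (beta G Z) (beta G X))) u
      + gF F Z (rhoF (br (beta G X) (beta G Y))) u

/-- Concurrent `π`-vector fields of a Finsler manifold `(M, F)` with geodesic spray `G`:
`∇_{βW} φ = -W = D°_{βW} φ` and `∇_{γW} φ = 0 = D°_{γW} φ` for all `W`. -/
structure IsConcurrent (F : TM n M → ℝ) (G : VField n M) (φ : PiField n M) : Prop where
  smooth : PiSmooth (slit n M) φ
  ne_zero : ∀ u ∈ slit n M, φ u ≠ 0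
  cartan_h : ∀ W, PiSmooth (slit n M) W → IsCartanH F G W φ (fun u => - W u)
  berwald_h : ∀ W, PiSmooth (slit n M) W → ∀ u ∈ slit n M, berwaldH G W φ u = - W u
  cartan_v : ∀ W, PiSmooth (slit n M) W → IsCartanV F G W φ (fun _ => 0)
  berwald_v : ∀ W, PiSmooth (slit n M) W → ∀ u ∈ slit n M, berwaldV G W φ u = 0

/-- `Φ = g(φ, η)`. -/
def Phi (F : TM n M → ℝ) (φ : PiField n M) : TM n M → ℝ := gF F φ eta

/-- `p² = g(φ, φ)`. -/
def pSq (F : TM n M → ℝ) (φ : PiField n M) : TM n M → ℝ := gF F φ φ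

/-- The conic domain `𝒟 = {F > Φ}` in the slit tangent bundle. -/
def conicDomain (F : TM n M → ℝ) (φ : PiField n M) : Set (TM n M) :=
  {u | u ∈ slit n M ∧ Phi F φ u < F u}

/-- The changed metric `F² / (F - Φ)`. -/
def matsumoto (F : TM n M → ℝ) (φ : PiField n M) : TM n M → ℝ :=
  fun u => F u ^ 2 / (F u - Phi F φ u)

/-- The function `F (1 + 2p²) - 3Φ`. -/
def Delta (F : TM n M → ℝ) (φ : PiField n M) : TM n M → ℝ :=
  fun u => F u * (1 + 2 * pSq F φ u) - 3 * Phi F φ u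

/-- `f₁ = F (4Φ - F) / (F (1 + 2p²) - 3Φ)`. -/
def f₁ (F : TM n M → ℝ) (φ : PiField n M) : TM n M → ℝ :=
  fun u => F u * (4 * Phi F φ u - F u) / Delta F φ u

/-- `f₂ = 2F³ / (F (1 + 2p²) - 3Φ)`. -/
def f₂ (F : TM n M → ℝ) (φ : PiField n M) : TM n M → ℝ :=
  fun u => 2 * F u ^ 3 / Delta F φ u

/-- The vector 1-form `𝕊 = -(f₁ J + d_J f₁ ⊗ γη - d_J f₂ ⊗ γφ) / 2`, as a linear map on each
tangent space of `TM`. -/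
def SForm (F : TM n M → ℝ) (φ : PiField n M) (u : TM n M) :
    TangentSpace (𝓡 n).tangent u →L[ℝ] TangentSpace (𝓡 n).tangent u :=
  -((1 / 2 : ℝ) • (f₁ F φ u • J u + (dJ (f₁ F φ) u).smulRight (gam u (eta u))
    - (dJ (f₂ F φ) u).smulRight (gam u (φ u))))

/-- The action of `𝕊` on vector fields. -/
def SF (F : TM n M → ℝ) (φ : PiField n M) (W : VField n M) : VField n M :=
  fun u => SForm F φ u (W u)

/-- A semi-basic (smooth) vector 1-form on `U ⊆ TM`: it vanishes on vertical vectors and has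
vertical values. -/
structure IsSemibasic (U : Set (TM n M))
    (L : (u : TM n M) → TangentSpace (𝓡 n).tangent u →L[ℝ] TangentSpace (𝓡 n).tangent u) :
    Prop where
  smooth : ∀ W, VSmooth U W → VSmooth U (fun u => L u (W u))
  vanish : ∀ u ∈ U, ∀ w, L u (J u w) = 0
  vertical : ∀ u ∈ U, ∀ w, J u (L u w) = 0

end

end FinslerGeom

namespace FinslerGeom

noncomputable section

open Set Bundle Filter Topology

variable {n : ℕ} {M : Type*} [TopologicalSpace M] [ChartedSpace (EuclideanSpace ℝ (Fin n)) M]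
  [IsManifold (𝓡 n) ∞ M]

/-- The model space of `M`. -/
local notation "𝔼" => EuclideanSpace ℝ (Fin n)

section Charts

instance isManifold_TM : IsManifold (𝓡 n).tangent ∞ (TM n M) :=
  inferInstanceAs (IsManifold ((𝓡 n).prod 𝓘(ℝ, 𝔼)) ∞ (TM n M))

instance isManifold_TM_min : IsManifold (𝓡 n).tangent (minSmoothness ℝ 3) (TM n M) := by
  rw [minSmoothness_of_isRCLikeNormedField]
  infer_instance

/-- The chart of `TM` induced by the preferred chart of `M` at `x`. -/
def ch (x : M) : PartialEquiv (TM n M) (𝔼 × 𝔼) :=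
  extChartAt (𝓡 n).tangent (⟨x, 0⟩ : TM n M)

/-- The parametrisation of `TM` inverse to the chart `ch x`. -/
def par (x : M) : 𝔼 × 𝔼 → TM n M := (ch x).symm

lemma isOpen_ch_target (x : M) : IsOpen (ch (n := n) x).target := isOpen_extChartAt_target _

lemma isOpen_ch_source (x : M) : IsOpen (ch (n := n) x).source := isOpen_extChartAt_source _

lemma mem_ch_source (u : TM n M) : u ∈ (ch u.proj).source := by
  simp [ch]

lemma mem_ch_source_iff (x : M) (u : TM n M) :
    u ∈ (ch x).source ↔ u.proj ∈ (chartAt 𝔼 x).source := by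
  simp [ch]

lemma ch_target (x : M) :
    (ch (n := n) x).target = (extChartAt (𝓡 n) x).target ×ˢ (univ : Set 𝔼) := by
  ext z
  simp only [ch, extChartAt, OpenPartialHomeomorph.extend, mfld_simps]
  exact TangentBundle.mem_chart_target_iff (I := 𝓡 n) z (⟨x, 0⟩ : TM n M)

lemma par_ch {x : M} {u : TM n M} (h : u ∈ (ch x).source) : par x (ch x u) = u :=
  (ch x).left_inv h

lemma ch_par {x : M} {z : 𝔼 × 𝔼} (h : z ∈ (ch x).target) : ch x (par x z) = z :=
  (ch x).right_inv h

lemma par_mem {x : M} {z : 𝔼 × 𝔼} (h : z ∈ (ch x).target) : par x z ∈ (ch x).source :=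
  (ch x).map_target h

lemma contMDiffOn_par (x : M) :
    ContMDiffOn 𝓘(ℝ, 𝔼 × 𝔼) (𝓡 n).tangent ∞ (par x) (ch (n := n) x).target :=
  contMDiffOn_extChartAt_symm _

lemma contMDiffAt_par {x : M} {z : 𝔼 × 𝔼} (h : z ∈ (ch x).target) :
    ContMDiffAt 𝓘(ℝ, 𝔼 × 𝔼) (𝓡 n).tangent ∞ (par x) z :=
  (contMDiffOn_par x).contMDiffAt ((isOpen_ch_target x).mem_nhds h)

lemma contMDiffAt_ch {x : M} {u : TM n M} (h : u ∈ (ch x).source) :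
    ContMDiffAt (𝓡 n).tangent 𝓘(ℝ, 𝔼 × 𝔼) ∞ (ch x) u :=
  contMDiffAt_extChartAt' (by simpa [ch, extChartAt_source] using h)

lemma mdifferentiableAt_par {x : M} {z : 𝔼 × 𝔼} (h : z ∈ (ch x).target) :
    MDifferentiableAt 𝓘(ℝ, 𝔼 × 𝔼) (𝓡 n).tangent (par x) z :=
  (contMDiffAt_par h).mdifferentiableAt (by simp)

/-- The differential of the parametrisation. -/
def dpar (x : M) (z : 𝔼 × 𝔼) : 𝔼 × 𝔼 →L[ℝ] TangentSpace (𝓡 n).tangent (par x z) :=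
  mfderiv 𝓘(ℝ, 𝔼 × 𝔼) (𝓡 n).tangent (par x) z

lemma isInvertible_dpar {x : M} {z : 𝔼 × 𝔼} (h : z ∈ (ch x).target) :
    (dpar (n := n) x z).IsInvertible := by
  have := isInvertible_mfderivWithin_extChartAt_symm (I := (𝓡 n).tangent)
    (x := (⟨x, 0⟩ : TM n M)) h
  have hr : range (𝓡 n).tangent = univ := ModelWithCorners.range_eq_univ _
  rw [hr, mfderivWithin_univ] at this
  exact this

/-- The coordinate representation of a vector field on `TM`. -/
def rep (x : M) (V : VField n M) (z : 𝔼 × 𝔼) : 𝔼 × 𝔼 := (dpar x z).inverse (V (par x z))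

lemma dpar_rep {x : M} {z : 𝔼 × 𝔼} (h : z ∈ (ch x).target) (V : VField n M) :
    dpar x z (rep x V z) = V (par x z) :=
  (isInvertible_dpar h).self_apply_inverse _

lemma rep_eq_iff {x : M} {z : 𝔼 × 𝔼} (h : z ∈ (ch x).target) (V : VField n M) (w : 𝔼 × 𝔼) :
    rep x V z = w ↔ V (par x z) = dpar x z w := by
  rw [← dpar_rep h V]
  exact ((isInvertible_dpar h).injective.eq_iff).symm

lemma mlieBracket_eq_lieBracket {E : Type*} [NormedAddCommGroup E] [NormedSpace ℝ E]
    (V W : E → E) (z : E) : mlieBracket 𝓘(ℝ, E) V W z = lieBracket ℝ V W z := by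
  have := congrFun (mlieBracketWithin_eq_lieBracketWithin (𝕜 := ℝ) (E := E) (V := V) (W := W)
    (s := univ)) z
  exact (congrFun (mlieBracketWithin_univ (I := 𝓘(ℝ, E))) z).symm.trans
    (this.trans (congrFun lieBracketWithin_univ z))

lemma rep_br {x : M} {z : 𝔼 × 𝔼} (h : z ∈ (ch x).target) {V W : VField n M}
    (hV : MDifferentiableAt (𝓡 n).tangent (𝓡 n).tangent.tangent
      (fun u => (⟨u, V u⟩ : TangentBundle (𝓡 n).tangent (TM n M))) (par x z))
    (hW : MDifferentiableAt (𝓡 n).tangent (𝓡 n).tangent.tangent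
      (fun u => (⟨u, W u⟩ : TangentBundle (𝓡 n).tangent (TM n M))) (par x z)) :
    rep x (br V W) z = lieBracket ℝ (rep x V) (rep x W) z := by
  have := mpullback_mlieBracket (I := 𝓘(ℝ, 𝔼 × 𝔼)) (I' := (𝓡 n).tangent) (f := par x) hV hW
    (contMDiffAt_par h) (by simpa using ENat.LEInfty.out)
  exact this.trans (mlieBracket_eq_lieBracket _ _ z)

end Charts

section Lifts

lemma par_proj (x : M) (z : 𝔼 × 𝔼) : (par x z).proj = (extChartAt (𝓡 n) x).symm z.1 := rfl

/-- The linear isomorphism of the model space onto a tangent space given by the chart at `x`. -/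
def lin (x p : M) : 𝔼 →L[ℝ] TangentSpace (𝓡 n) p :=
  (trivializationAt 𝔼 (TangentSpace (𝓡 n)) x).symmL ℝ p

/-- The inverse of `lin`. -/
def linInv (x p : M) : TangentSpace (𝓡 n) p →L[ℝ] 𝔼 :=
  (trivializationAt 𝔼 (TangentSpace (𝓡 n)) x).continuousLinearMapAt ℝ p

lemma par_proj_mem {x : M} {z : 𝔼 × 𝔼} (h : z ∈ (ch x).target) :
    (par x z).proj ∈ (chartAt 𝔼 x).source :=
  (mem_ch_source_iff x _).1 (par_mem h)

lemma lin_linInv {x p : M} (h : p ∈ (chartAt 𝔼 x).source) (a : TangentSpace (𝓡 n) p) :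
    lin x p (linInv x p a) = a :=
  (trivializationAt 𝔼 (TangentSpace (𝓡 n)) x).symmL_continuousLinearMapAt (R := ℝ) h a

lemma linInv_lin {x p : M} (h : p ∈ (chartAt 𝔼 x).source) (a : 𝔼) :
    linInv (n := n) x p (lin x p a) = a :=
  (trivializationAt 𝔼 (TangentSpace (𝓡 n)) x).continuousLinearMapAt_symmL (R := ℝ) h a

lemma ch_apply {x : M} {u : TM n M} (h : u ∈ (ch x).source) :
    ch x u = (extChartAt (𝓡 n) x u.proj, linInv x u.proj u.2) := by
  rw [mem_ch_source_iff] at h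
  simp only [ch, linInv]
  rw [Trivialization.continuousLinearMapAt_apply, Trivialization.coe_linearMapAt_of_mem _ h]
  rfl

lemma par_snd {x : M} {z : 𝔼 × 𝔼} (h : z ∈ (ch x).target) :
    (par x z).2 = lin x (par x z).proj z.2 := by
  have h1 := ch_apply (par_mem h)
  rw [ch_par h] at h1
  have h2 : z.2 = linInv x (par x z).proj (par x z).2 := congrArg Prod.snd h1
  rw [h2, lin_linInv (par_proj_mem h)]

lemma fibre_eq_par {x : M} {z : 𝔼 × 𝔼} (h : z ∈ (ch x).target) (w : 𝔼) :
    (⟨(par x z).proj, w⟩ : TM n M) = par x (z.1, linInv x (par x z).proj w) := by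
  have h' : (⟨(par x z).proj, w⟩ : TM n M) ∈ (ch x).source :=
    (mem_ch_source_iff x _).2 (par_proj_mem h)
  rw [← par_ch h', ch_apply h']
  congr 2
  rw [par_proj]
  refine (extChartAt (𝓡 n) x).right_inv ?_
  rw [ch_target] at h
  exact h.1

lemma linInv_par {x : M} {z : 𝔼 × 𝔼} (h : z ∈ (ch x).target) :
    linInv x (par x z).proj (par x z).2 = z.2 := by
  rw [par_snd h, linInv_lin (par_proj_mem h)]

lemma gam_par {x : M} {z : 𝔼 × 𝔼} (h : z ∈ (ch x).target)
    (a : TangentSpace (𝓡 n) (par x z).proj) :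
    gam (par x z) a = dpar x z (0, linInv x (par x z).proj a) := by
  let A : 𝔼 →L[ℝ] 𝔼 := linInv x (par x z).proj
  let y : 𝔼 := (par x z).2
  have hl : HasMFDerivAt 𝓘(ℝ, 𝔼) 𝓘(ℝ, 𝔼 × 𝔼) (fun w : 𝔼 => ((z.1, A w) : 𝔼 × 𝔼)) (par x z).2
      ((0 : 𝔼 →L[ℝ] 𝔼).prod A) :=
    ((hasFDerivAt_const z.1 _).prodMk A.hasFDerivAt).hasMFDerivAt
  have hz : ((z.1, A y) : 𝔼 × 𝔼) = z := by
    refine Prod.ext rfl (linInv_par h)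
  have hp : HasMFDerivAt 𝓘(ℝ, 𝔼 × 𝔼) (𝓡 n).tangent (par x) (z.1, A y) (dpar x z) := by
    rw [hz]; exact (mdifferentiableAt_par h).hasMFDerivAt
  have hc := (HasMFDerivAt.comp y hp hl).mfderiv
  have hf : (fun w : 𝔼 => (⟨(par x z).proj, w⟩ : TM n M))
      = par x ∘ (fun w : 𝔼 => ((z.1, A w) : 𝔼 × 𝔼)) := funext fun w => fibre_eq_par h w
  unfold gam
  rw [hf]
  exact congrArg (fun T => T a) hc

lemma rho_par {x : M} {z : 𝔼 × 𝔼} (h : z ∈ (ch x).target) (v : 𝔼 × 𝔼) :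
    rho (par x z) (dpar x z v) = lin x (par x z).proj v.1 := by
  have hs : MDifferentiableAt (𝓡 n).tangent (𝓡 n) (fun p : TM n M => p.proj) (par x z) :=
    mdifferentiableAt_proj _
  have hc := HasMFDerivAt.comp z hs.hasMFDerivAt (mdifferentiableAt_par h).hasMFDerivAt
  have hf : (fun p : TM n M => p.proj) ∘ par x = (extChartAt (𝓡 n) x).symm ∘ Prod.fst := rfl
  have hz : z.1 ∈ (extChartAt (𝓡 n) x).target := by rw [ch_target] at h; exact h.1
  have h2 := mdifferentiableWithinAt_extChartAt_symm hz
  rw [ModelWithCorners.range_eq_univ, mdifferentiableWithinAt_univ] at h2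
  have hfst : HasMFDerivAt 𝓘(ℝ, 𝔼 × 𝔼) 𝓘(ℝ, 𝔼) Prod.fst z (ContinuousLinearMap.fst ℝ 𝔼 𝔼) :=
    hasFDerivAt_fst.hasMFDerivAt
  have h3 := HasMFDerivAt.comp z h2.hasMFDerivAt hfst
  rw [hf] at hc
  have h4 := hasMFDerivAt_unique hc h3
  have h5 := TangentBundle.symmL_trivializationAt (I := 𝓡 n) (par_proj_mem h)
  rw [ModelWithCorners.range_eq_univ, mfderivWithin_univ, par_proj,
    (extChartAt (𝓡 n) x).right_inv hz] at h5
  refine (congrArg (fun T => T v) h4).trans ?_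
  exact (congrArg (fun T => T v.1) h5).symm

lemma J_par {x : M} {z : 𝔼 × 𝔼} (h : z ∈ (ch x).target) (v : 𝔼 × 𝔼) :
    J (par x z) (dpar x z v) = dpar x z (0, v.1) := by
  have : J (par x z) (dpar x z v) = gam (par x z) (rho (par x z) (dpar x z v)) := rfl
  rw [this, rho_par h, gam_par h, linInv_lin (par_proj_mem h)]

lemma dFun_par {x : M} {z : 𝔼 × 𝔼} (h : z ∈ (ch x).target) {f : TM n M → ℝ}
    (hf : MDifferentiableAt (𝓡 n).tangent 𝓘(ℝ, ℝ) f (par x z)) (v : 𝔼 × 𝔼) :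
    dFun f (par x z) (dpar x z v) = fderiv ℝ (f ∘ par x) z v := by
  have hc := (HasMFDerivAt.comp z hf.hasMFDerivAt (mdifferentiableAt_par h).hasMFDerivAt).mfderiv
  rw [mfderiv_eq_fderiv] at hc
  exact (congrArg (fun T => T v) hc).symm

/-- The coordinate representation of a `π`-vector field. -/
def repP (x : M) (X : PiField n M) (z : 𝔼 × 𝔼) : 𝔼 := linInv x (par x z).proj (X (par x z))

lemma lin_repP {x : M} {z : 𝔼 × 𝔼} (h : z ∈ (ch x).target) (X : PiField n M) :
    lin x (par x z).proj (repP x X z) = X (par x z) :=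
  lin_linInv (par_proj_mem h) _

lemma rep_gamF {x : M} {z : 𝔼 × 𝔼} (h : z ∈ (ch x).target) (X : PiField n M) :
    rep x (gamF X) z = (0, repP x X z) :=
  (rep_eq_iff h _ _).2 (gam_par h _)

lemma repP_eta {x : M} {z : 𝔼 × 𝔼} (h : z ∈ (ch x).target) : repP x (eta (n := n)) z = z.2 :=
  linInv_par h

lemma rep_liouville {x : M} {z : 𝔼 × 𝔼} (h : z ∈ (ch x).target) :
    rep x (liouville (n := n)) z = (0, z.2) := by
  rw [liouville, rep_gamF h, repP_eta h]

lemma rep_JF {x : M} {z : 𝔼 × 𝔼} (h : z ∈ (ch x).target) (W : VField n M) :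
    rep x (JF W) z = (0, (rep x W z).1) := by
  refine (rep_eq_iff h _ _).2 ?_
  rw [JF, ← dpar_rep h W, J_par h]

lemma rho_rep {x : M} {z : 𝔼 × 𝔼} (h : z ∈ (ch x).target) (W : VField n M) :
    rho (par x z) (W (par x z)) = lin x (par x z).proj (rep x W z).1 := by
  rw [← dpar_rep h W, rho_par h]

lemma repP_rhoF {x : M} {z : 𝔼 × 𝔼} (h : z ∈ (ch x).target) (W : VField n M) :
    repP x (rhoF W) z = (rep x W z).1 := by
  rw [repP, rhoF, rho_rep h, linInv_lin (par_proj_mem h)]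

end Lifts

section Smoothness

/-- Smoothness of a vector field on `TM` at a point. -/
def VSmoothAt (V : VField n M) (u : TM n M) : Prop :=
  ContMDiffAt (𝓡 n).tangent (𝓡 n).tangent.tangent ∞
    (fun u => (⟨u, V u⟩ : TangentBundle (𝓡 n).tangent (TM n M))) u

/-- Smoothness of a `π`-vector field at a point. -/
def PiSmoothAt (X : PiField n M) (u : TM n M) : Prop :=
  ContMDiffAt (𝓡 n).tangent (𝓡 n).tangent ∞ (fun u => (⟨u.proj, X u⟩ : TM n M)) u

lemma VSmooth.at {U : Set (TM n M)} (hU : IsOpen U) {V : VField n M} (hV : VSmooth U V)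
    {u : TM n M} (hu : u ∈ U) : VSmoothAt V u :=
  ContMDiffOn.contMDiffAt hV (hU.mem_nhds hu)

lemma PiSmooth.at {U : Set (TM n M)} (hU : IsOpen U) {X : PiField n M} (hX : PiSmooth U X)
    {u : TM n M} (hu : u ∈ U) : PiSmoothAt X u :=
  ContMDiffOn.contMDiffAt hX (hU.mem_nhds hu)

lemma VSmoothAt.congr {V W : VField n M} {u : TM n M} (hV : VSmoothAt V u) (h : W =ᶠ[𝓝 u] V) :
    VSmoothAt W u := by
  refine ContMDiffAt.congr_of_eventuallyEq hV ?_
  filter_upwards [h] with p hp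
  rw [hp]

lemma VSmoothAt.mdiff {V : VField n M} {u : TM n M} (hV : VSmoothAt V u) :
    MDifferentiableAt (𝓡 n).tangent (𝓡 n).tangent.tangent
      (fun u => (⟨u, V u⟩ : TangentBundle (𝓡 n).tangent (TM n M))) u :=
  ContMDiffAt.mdifferentiableAt hV (by simp)

lemma continuousAt_ch {x : M} {u : TM n M} (h : u ∈ (ch x).source) : ContinuousAt (ch x) u :=
  (contMDiffAt_ch h).continuousAt

lemma continuousAt_par {x : M} {z : 𝔼 × 𝔼} (h : z ∈ (ch x).target) :
    ContinuousAt (par (n := n) x) z :=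
  (contMDiffAt_par h).continuousAt

lemma eventually_mem_target {x : M} {z : 𝔼 × 𝔼} (h : z ∈ (ch x).target) :
    ∀ᶠ z' in 𝓝 z, z' ∈ (ch (n := n) x).target := (isOpen_ch_target x).mem_nhds h

lemma VSmoothAt.rep {x : M} {z : 𝔼 × 𝔼} (h : z ∈ (ch x).target) {V : VField n M}
    (hV : VSmoothAt V (par x z)) : ContDiffAt ℝ ∞ (rep x V) z := by
  have := ContMDiffAt.mpullback_vectorField_preimage (I := 𝓘(ℝ, 𝔼 × 𝔼)) (I' := (𝓡 n).tangent)
    (f := par x) (m := ∞) (n := ∞) hV (contMDiffAt_par h) (isInvertible_dpar h) (by simp)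
  exact contMDiffAt_vectorSpace_iff_contDiffAt.1 this

lemma PiSmoothAt.repP {x : M} {z : 𝔼 × 𝔼} (h : z ∈ (ch x).target) {X : PiField n M}
    (hX : PiSmoothAt X (par x z)) : ContDiffAt ℝ ∞ (repP x X) z := by
  have h0 : (⟨(par x z).proj, X (par x z)⟩ : TM n M) ∈ (ch x).source :=
    (mem_ch_source_iff x _).2 (par_proj_mem h)
  have h1 := (contMDiffAt_ch h0).comp z (ContMDiffAt.comp z hX (contMDiffAt_par h))
  have h2 := contMDiffAt_iff_contDiffAt.1 h1
  refine (contDiffAt_snd.comp z h2).congr_of_eventuallyEq ?_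
  filter_upwards [eventually_mem_target h] with z' hz'
  have h3 : (⟨(par x z').proj, X (par x z')⟩ : TM n M) ∈ (ch x).source :=
    (mem_ch_source_iff x _).2 (par_proj_mem hz')
  simp only [Function.comp_apply]
  rw [ch_apply h3]
  rfl

lemma contDiffAt_comp_par {x : M} {z : 𝔼 × 𝔼} (h : z ∈ (ch x).target) {f : TM n M → ℝ}
    (hf : ContMDiffAt (𝓡 n).tangent 𝓘(ℝ, ℝ) ∞ f (par x z)) : ContDiffAt ℝ ∞ (f ∘ par x) z :=
  contMDiffAt_iff_contDiffAt.1 (ContMDiffAt.comp z hf (contMDiffAt_par h))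

lemma eventuallyEq_comp_ch {x : M} {u : TM n M} (h : u ∈ (ch x).source) {α : Type*}
    (f : TM n M → α) : f =ᶠ[𝓝 u] (f ∘ par x) ∘ ch x := by
  filter_upwards [(isOpen_ch_source x).mem_nhds h] with p hp
  simp only [Function.comp_apply]
  rw [par_ch hp]

lemma dFun_rep {x : M} {z : 𝔼 × 𝔼} (h : z ∈ (ch x).target) (f : TM n M → ℝ) (V : VField n M) :
    dFun f (par x z) (V (par x z)) = fderiv ℝ (f ∘ par x) z (rep x V z) := by
  rw [← dpar_rep h V]
  by_cases hf : DifferentiableAt ℝ (f ∘ par x) z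
  · refine dFun_par h ?_ _
    have h1 : MDifferentiableAt 𝓘(ℝ, 𝔼 × 𝔼) 𝓘(ℝ, ℝ) (f ∘ par x) (ch x (par x z)) := by
      rw [ch_par h]; exact hf.mdifferentiableAt
    exact (MDifferentiableAt.comp (par x z) h1
      ((contMDiffAt_ch (par_mem h)).mdifferentiableAt (by simp))).congr_of_eventuallyEq
      (eventuallyEq_comp_ch (par_mem h) f)
  · have h2 : ¬ MDifferentiableAt (𝓡 n).tangent 𝓘(ℝ, ℝ) f (par x z) := fun h2 =>
      hf (mdifferentiableAt_iff_differentiableAt.1 (h2.comp z (mdifferentiableAt_par h)))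
    rw [fderiv_zero_of_not_differentiableAt hf, dFun, mfderiv_zero_of_not_mdifferentiableAt h2]
    rfl

/-- The vector field on the domain of the chart `ch x` with given coordinate representation. -/
def ofRep (x : M) (w : 𝔼 × 𝔼 → 𝔼 × 𝔼) : VField n M := fun u =>
  (mfderiv (𝓡 n).tangent 𝓘(ℝ, 𝔼 × 𝔼) (ch x) u).inverse (w (ch x u))

lemma vSmoothAt_ofRep {x : M} {u : TM n M} (h : u ∈ (ch x).source) {w : 𝔼 × 𝔼 → 𝔼 × 𝔼}
    (hw : ContDiffAt ℝ ∞ w (ch x u)) : VSmoothAt (ofRep x w) u :=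
  ContMDiffAt.mpullback_vectorField_preimage (I' := 𝓘(ℝ, 𝔼 × 𝔼)) (I := (𝓡 n).tangent)
    (f := ch x) (m := ∞) (n := ∞) (contMDiffAt_vectorSpace_iff_contDiffAt.2 hw)
    (contMDiffAt_ch h) (isInvertible_mfderiv_extChartAt h) (by simp)

lemma ofRep_par {x : M} {z : 𝔼 × 𝔼} (h : z ∈ (ch x).target) (w : 𝔼 × 𝔼 → 𝔼 × 𝔼) :
    ofRep x w (par x z) = dpar (n := n) x z (w z) := by
  have h1 := mfderiv_extChartAt_comp_mfderivWithin_extChartAt_symm (I := (𝓡 n).tangent)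
    (x := (⟨x, 0⟩ : TM n M)) h
  have hr : range (𝓡 n).tangent = univ := ModelWithCorners.range_eq_univ _
  rw [hr, mfderivWithin_univ] at h1
  have h2 : mfderiv (𝓡 n).tangent 𝓘(ℝ, 𝔼 × 𝔼) (ch x) (par x z) (dpar x z (w z)) = w z :=
    congrArg (fun T => T (w z)) h1
  have h3 := isInvertible_mfderiv_extChartAt (I := (𝓡 n).tangent) (par_mem h)
  unfold ofRep
  rw [ch_par h]
  refine h3.injective ?_
  exact (h3.self_apply_inverse (w z)).trans h2.symm

lemma rep_ofRep {x : M} {z : 𝔼 × 𝔼} (h : z ∈ (ch x).target) (w : 𝔼 × 𝔼 → 𝔼 × 𝔼) :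
    rep (n := n) x (ofRep x w) z = w z :=
  (rep_eq_iff h _ _).2 (ofRep_par h w)

lemma VSmoothAt_of_rep {x : M} {z : 𝔼 × 𝔼} (h : z ∈ (ch x).target) {V : VField n M}
    (hV : ContDiffAt ℝ ∞ (FinslerGeom.rep x V) z) : VSmoothAt V (par x z) := by
  have h1 : VSmoothAt (ofRep x (FinslerGeom.rep x V)) (par x z) :=
    vSmoothAt_ofRep (par_mem h) (by rwa [ch_par h])
  refine h1.congr ?_
  filter_upwards [(isOpen_ch_source x).mem_nhds (par_mem h)] with p hp
  have h2 := ofRep_par ((ch x).map_source hp) (FinslerGeom.rep x V)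
  rw [dpar_rep ((ch x).map_source hp), par_ch hp] at h2
  exact h2.symm

lemma mem_slit_par {x : M} {z : 𝔼 × 𝔼} (h : z ∈ (ch x).target) :
    par x z ∈ slit n M ↔ z.2 ≠ 0 := by
  have h1 := par_snd h
  have h2 := linInv_par h
  refine not_congr ⟨fun h3 => ?_, fun h3 => ?_⟩
  · rw [← h2, h3, map_zero]
  · rw [h1, h3, map_zero]

lemma isOpen_of_forall_par {U : Set (TM n M)}
    (hU : ∀ (x : M) (z : 𝔼 × 𝔼), z ∈ (ch x).target → par x z ∈ U →
      ∀ᶠ z' in 𝓝 z, z' ∈ (ch x).target → par x z' ∈ U) : IsOpen U := by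
  refine isOpen_iff_mem_nhds.2 fun u hu => ?_
  have hs := mem_ch_source u
  have ht := (ch u.proj).map_source hs
  have h1 := hU u.proj (ch u.proj u) ht (by rwa [par_ch hs])
  filter_upwards [(continuousAt_ch hs).eventually h1, (isOpen_ch_source _).mem_nhds hs] with p hp hp'
  have := hp ((ch u.proj).map_source hp')
  rwa [par_ch hp'] at this

lemma isOpen_slit : IsOpen (slit n M) := by
  refine isOpen_of_forall_par fun x z hz h => ?_
  rw [mem_slit_par hz] at h
  filter_upwards [(isOpen_ne.preimage continuous_snd).mem_nhds h] with z' hz' ht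
  exact (mem_slit_par ht).2 hz'

end Smoothness

section Sprays

/-- Smooth vector fields `G` on the open set `U` with `J G = C`. -/
structure IsSemispray (U : Set (TM n M)) (G : VField n M) : Prop where
  isOpen : IsOpen U
  smooth : VSmooth U G
  J_eq : ∀ u ∈ U, J u (G u) = liouville u

lemma IsGeodesicSpray.isSemispray {U : Set (TM n M)} (hU : IsOpen U) {F : TM n M → ℝ}
    {G : VField n M} (hG : IsGeodesicSpray U F G) : IsSemispray U G :=
  ⟨hU, hG.smooth, hG.J_eq⟩

/-- The vertical component of a spray in the chart `ch x`. -/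
def spr (x : M) (G : VField n M) (z : 𝔼 × 𝔼) : 𝔼 := (rep x G z).2

variable {U : Set (TM n M)} {G : VField n M} {x : M} {z : EuclideanSpace ℝ (Fin n) × EuclideanSpace ℝ (Fin n)}

lemma eventually_par_mem (hU : IsOpen U) (h : z ∈ (ch x).target) (hu : par x z ∈ U) :
    ∀ᶠ z' in 𝓝 z, z' ∈ (ch (n := n) x).target ∧ par x z' ∈ U := by
  have h1 := eventually_mem_target h
  have h2 := (continuousAt_par h).eventually (hU.mem_nhds hu)
  exact h1.and h2

lemma IsSemispray.rep_eq (hG : IsSemispray U G) (h : z ∈ (ch x).target) (hu : par x z ∈ U) :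
    rep x G z = (z.2, spr x G z) := by
  refine Prod.ext ?_ rfl
  have h1 := hG.J_eq _ hu
  have h2 : rep x (JF G) z = rep x liouville z := by
    rw [rep_eq_iff h, dpar_rep h]
    exact h1
  rw [rep_JF h, rep_liouville h] at h2
  exact congrArg Prod.snd h2

lemma IsSemispray.contDiffAt_spr (hG : IsSemispray U G) (h : z ∈ (ch x).target)
    (hu : par x z ∈ U) : ContDiffAt ℝ ∞ (spr x G) z :=
  contDiffAt_snd.comp z ((hG.smooth.at hG.isOpen hu).rep h)

lemma IsSemispray.rep_eventuallyEq (hG : IsSemispray U G) (h : z ∈ (ch x).target)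
    (hu : par x z ∈ U) : rep x G =ᶠ[𝓝 z] fun z' => (z'.2, spr x G z') := by
  filter_upwards [eventually_par_mem hG.isOpen h hu] with z' hz'
  exact hG.rep_eq hz'.1 hz'.2

lemma rep_add (V W : VField n M) : rep x (fun u => V u + W u) z = rep x V z + rep x W z :=
  map_add _ _ _

lemma rep_sub (V W : VField n M) : rep x (fun u => V u - W u) z = rep x V z - rep x W z :=
  map_sub _ _ _

lemma rep_smul (c : ℝ) (V : VField n M) : rep x (fun u => c • V u) z = c • rep x V z :=
  map_smul _ _ _

lemma rep_J_apply (h : z ∈ (ch x).target) (V : VField n M) :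
    rep x (fun u => J u (V u)) z = (0, (rep x V z).1) := rep_JF h V

lemma rep_inj (h : z ∈ (ch x).target) {V W : VField n M} (hVW : rep x V z = rep x W z) :
    V (par x z) = W (par x z) := by
  rw [← dpar_rep h V, hVW, dpar_rep h W]

lemma VSmoothAt.JF (h : z ∈ (ch x).target) {W : VField n M} (hW : VSmoothAt W (par x z)) :
    VSmoothAt (JF W) (par x z) := by
  refine VSmoothAt_of_rep h ?_
  have h1 : ContDiffAt ℝ ∞ (fun z' => ((0, (FinslerGeom.rep x W z').1) : 𝔼 × 𝔼)) z :=
    contDiffAt_const.prodMk (contDiffAt_fst.comp z (hW.rep h))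
  refine h1.congr_of_eventuallyEq ?_
  filter_upwards [eventually_mem_target h] with z' hz'
  exact rep_JF hz' W

lemma rep_br' (h : z ∈ (ch x).target) {V W : VField n M} (hV : VSmoothAt V (par x z))
    (hW : VSmoothAt W (par x z)) :
    rep x (br V W) z = fderiv ℝ (rep x W) z (rep x V z) - fderiv ℝ (rep x V) z (rep x W z) :=
  rep_br h hV.mdiff hW.mdiff

lemma rep_barthel (hG : IsSemispray U G) (h : z ∈ (ch x).target) (hu : par x z ∈ U)
    {W : VField n M} (hW : VSmoothAt W (par x z)) :
    rep x (barthel G W) z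
      = ((rep x W z).1, fderiv ℝ (spr x G) z (0, (rep x W z).1) - (rep x W z).2) := by
  have hGs := hG.smooth.at hG.isOpen hu
  have hWr := (hW.rep h).differentiableAt (by simp)
  have hs := (hG.contDiffAt_spr h hu).differentiableAt (by simp)
  have e1 : rep x (barthel G W) z = rep x (br (JF W) G) z - rep x (fun u => J u (br W G u)) z :=
    rep_sub _ _
  have dG : HasFDerivAt (rep x G)
      ((ContinuousLinearMap.snd ℝ 𝔼 𝔼).prod (fderiv ℝ (spr x G) z)) z :=
    (hasFDerivAt_snd.prodMk hs.hasFDerivAt).congr_of_eventuallyEq (hG.rep_eventuallyEq h hu)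
  have dW := hWr.hasFDerivAt
  have dJW : HasFDerivAt (rep x (JF W))
      ((0 : 𝔼 × 𝔼 →L[ℝ] 𝔼).prod ((ContinuousLinearMap.fst ℝ 𝔼 𝔼).comp (fderiv ℝ (rep x W) z))) z := by
    refine ((hasFDerivAt_const (0 : 𝔼) z).prodMk (hasFDerivAt_fst.comp z dW)).congr_of_eventuallyEq ?_
    filter_upwards [eventually_mem_target h] with z' hz'
    exact rep_JF hz' W
  rw [e1, rep_J_apply h, rep_br' h (hW.JF h) hGs, rep_br' h hW hGs, dG.fderiv, dJW.fderiv,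
    rep_JF h, hG.rep_eq h hu]
  refine Prod.ext ?_ ?_
  · simp
  · simp

lemma rep_hProj (hG : IsSemispray U G) (h : z ∈ (ch x).target) (hu : par x z ∈ U)
    {W : VField n M} (hW : VSmoothAt W (par x z)) :
    rep x (hProj G W) z = ((rep x W z).1, (1 / 2 : ℝ) • fderiv ℝ (spr x G) z (0, (rep x W z).1)) := by
  have e1 : rep x (hProj G W) z = (1 / 2 : ℝ) • (rep x W z + rep x (barthel G W) z) :=
    (rep_smul _ _).trans (congrArg _ (rep_add _ _))
  rw [e1, rep_barthel hG h hu hW]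
  refine Prod.ext ?_ ?_
  · simp only [Prod.smul_fst, Prod.fst_add]; module
  · simp only [Prod.smul_snd, Prod.snd_add]; module

lemma rep_vProj (hG : IsSemispray U G) (h : z ∈ (ch x).target) (hu : par x z ∈ U)
    {W : VField n M} (hW : VSmoothAt W (par x z)) :
    rep x (vProj G W) z
      = (0, (rep x W z).2 - (1 / 2 : ℝ) • fderiv ℝ (spr x G) z (0, (rep x W z).1)) := by
  have e1 : rep x (vProj G W) z = (1 / 2 : ℝ) • (rep x W z - rep x (barthel G W) z) :=
    (rep_smul _ _).trans (congrArg _ (rep_sub _ _))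
  rw [e1, rep_barthel hG h hu hW]
  refine Prod.ext ?_ ?_
  · simp only [Prod.smul_fst, Prod.fst_sub]; module
  · simp only [Prod.smul_snd, Prod.snd_sub]; module

lemma fderiv_spr_vert_self (hG : IsSemispray U G) (hh : ∀ u ∈ U, br liouville G u = G u)
    (h : z ∈ (ch x).target) (hu : par x z ∈ U) :
    fderiv ℝ (spr x G) z (0, z.2) = (2 : ℝ) • spr x G z := by
  have hs := (hG.contDiffAt_spr h hu).differentiableAt (by simp)
  have dG : HasFDerivAt (rep x G)
      ((ContinuousLinearMap.snd ℝ 𝔼 𝔼).prod (fderiv ℝ (spr x G) z)) z :=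
    (hasFDerivAt_snd.prodMk hs.hasFDerivAt).congr_of_eventuallyEq (hG.rep_eventuallyEq h hu)
  have eC : rep x (liouville (n := n)) =ᶠ[𝓝 z] fun z' => (0, z'.2) := by
    filter_upwards [eventually_mem_target h] with z' hz'
    exact rep_liouville hz'
  have dC : HasFDerivAt (rep x (liouville (n := n)))
      ((0 : 𝔼 × 𝔼 →L[ℝ] 𝔼).prod (ContinuousLinearMap.snd ℝ 𝔼 𝔼)) z :=
    ((hasFDerivAt_const (0 : 𝔼) z).prodMk hasFDerivAt_snd).congr_of_eventuallyEq eC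
  have hC : VSmoothAt (liouville (n := n) (M := M)) (par x z) :=
    VSmoothAt_of_rep h ((contDiffAt_const.prodMk contDiffAt_snd).congr_of_eventuallyEq eC)
  have h1 : rep x (br liouville G) z = rep x G z := by
    rw [rep_eq_iff h, dpar_rep h]; exact hh _ hu
  rw [rep_br' h hC (hG.smooth.at hG.isOpen hu), dG.fderiv, dC.fderiv, rep_liouville h,
    hG.rep_eq h hu] at h1
  have h2 := congrArg Prod.snd h1
  simp only [Prod.snd_sub, ContinuousLinearMap.prod_apply, ContinuousLinearMap.coe_snd'] at h2
  rw [two_smul]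
  exact sub_eq_iff_eq_add.1 h2

lemma vSmoothAt_hProj (hG : IsSemispray U G) (h : z ∈ (ch x).target) (hu : par x z ∈ U)
    {W : VField n M} (hW : VSmooth U W) : VSmoothAt (hProj G W) (par x z) := by
  have hr := (hW.at hG.isOpen hu).rep h
  have hs : ContDiffAt ℝ ∞ (fderiv ℝ (spr x G)) z :=
    (hG.contDiffAt_spr h hu).fderiv_right (by simp)
  have h1 : ContDiffAt ℝ ∞ (fun z' => (((FinslerGeom.rep x W z').1, (1 / 2 : ℝ) •
      fderiv ℝ (spr x G) z' (0, (FinslerGeom.rep x W z').1)) : 𝔼 × 𝔼)) z := by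
    have h2 := contDiffAt_fst.comp z hr
    exact h2.prodMk ((hs.clm_apply (contDiffAt_const.prodMk h2)).const_smul (1 / 2 : ℝ))
  refine VSmoothAt_of_rep h (h1.congr_of_eventuallyEq ?_)
  filter_upwards [eventually_par_mem hG.isOpen h hu] with z' hz'
  exact rep_hProj hG hz'.1 hz'.2 (hW.at hG.isOpen hz'.2)

/-- The first derivative of a function in the fibre direction is a full derivative. -/
lemma fderiv_slice {f : 𝔼 × 𝔼 → ℝ} {z : 𝔼 × 𝔼} (hf : DifferentiableAt ℝ f z) (b : 𝔼) :
    fderiv ℝ (fun w => f (z.1, w)) z.2 b = fderiv ℝ f z (0, b) := by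
  have hl : HasFDerivAt (fun w : 𝔼 => ((z.1, w) : 𝔼 × 𝔼))
      ((0 : 𝔼 →L[ℝ] 𝔼).prod (ContinuousLinearMap.id ℝ 𝔼)) z.2 :=
    (hasFDerivAt_const z.1 _).prodMk (hasFDerivAt_id _)
  have := (hf.hasFDerivAt (x := (z.1, z.2))).comp z.2 hl
  rw [show (fun w => f (z.1, w)) = f ∘ fun w => (z.1, w) from rfl, this.fderiv]
  simp

lemma fderiv_fderiv_comp_equiv {E : Type*} [NormedAddCommGroup E] [NormedSpace ℝ E]
    (L : E ≃L[ℝ] E) (f : E → ℝ) (y a b : E) :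
    fderiv ℝ (fun y => fderiv ℝ (f ∘ L) y b) y a
      = fderiv ℝ (fun y => fderiv ℝ f y (L b)) (L y) (L a) := by
  have h1 : (fun y => fderiv ℝ (f ∘ L) y b) = (fun y => fderiv ℝ f y (L b)) ∘ L := by
    funext y
    rw [L.comp_right_fderiv]
    rfl
  rw [h1, L.comp_right_fderiv]
  rfl

lemma metric_par {F : TM n M → ℝ} (h : z ∈ (ch x).target)
    (hF : ContDiffAt ℝ ∞ (energy F ∘ par x) z) (a b : TangentSpace (𝓡 n) (par x z).proj) :
    metric F (par x z) a b = fderiv ℝ (fun z' => fderiv ℝ (energy F ∘ par x) z'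
      (0, linInv x (par x z).proj b)) z (0, linInv x (par x z).proj a) := by
  set e := energy F ∘ par x with he
  let A : 𝔼 →L[ℝ] 𝔼 := linInv x (par x z).proj
  let B : 𝔼 →L[ℝ] 𝔼 := lin x (par x z).proj
  have hAB : ∀ y, A (B y) = y := fun y => linInv_lin (par_proj_mem h) y
  have hBA : ∀ y, B (A y) = y := fun y => lin_linInv (par_proj_mem h) y
  let L : 𝔼 ≃L[ℝ] 𝔼 := ContinuousLinearEquiv.equivOfInverse A B hBA hAB
  have e1 : (fun w : 𝔼 => energy F (⟨(par x z).proj, w⟩ : TM n M)) = (fun y => e (z.1, y)) ∘ L := by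
    funext w
    rw [fibre_eq_par h]
    rfl
  have e2 : metric F (par x z) a b
      = fderiv ℝ (fun y => fderiv ℝ (fun w => e (z.1, w)) y (A b)) z.2 (A a) := by
    unfold metric
    rw [e1, ← linInv_par h]
    exact fderiv_fderiv_comp_equiv L (fun y => e (z.1, y)) (par x z).2 a b
  rw [e2]
  have hcts : ContinuousAt (fun w : 𝔼 => ((z.1, w) : 𝔼 × 𝔼)) z.2 := by fun_prop
  have hev : ∀ᶠ w in 𝓝 z.2, DifferentiableAt ℝ e (z.1, w) := by
    have h1 : ∀ᶠ z' in 𝓝 z, ContDiffAt ℝ 1 e z' :=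
      (hF.of_le (by simp)).eventually (by simp)
    exact (hcts.eventually h1).mono fun w hw => hw.differentiableAt (by simp)
  have e3 : (fun y => fderiv ℝ (fun w => e (z.1, w)) y (A b)) =ᶠ[𝓝 z.2]
      fun y => fderiv ℝ e (z.1, y) (0, A b) :=
    hev.mono fun w hw => fderiv_slice (z := (z.1, w)) hw (A b)
  rw [e3.fderiv_eq]
  have hd : DifferentiableAt ℝ (fun z' => fderiv ℝ e z' (0, A b)) z :=
    ((hF.fderiv_right (m := ∞) (by simp)).clm_apply contDiffAt_const).differentiableAt (by simp)
  exact fderiv_slice (f := fun z' => fderiv ℝ e z' (0, A b)) hd (A a)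

end Sprays

section FlatEnergy

section Flat

variable {E : Type*} [NormedAddCommGroup E] [NormedSpace ℝ E]

lemma fderiv_fderiv_apply {V H : Type*} [NormedAddCommGroup V] [NormedSpace ℝ V]
    [NormedAddCommGroup H] [NormedSpace ℝ H] {f : V → H} {z : V}
    (hf : ContDiffAt ℝ ∞ f z) {c : V → V} {c' : V →L[ℝ] V} (hc : HasFDerivAt c c' z) (w : V) :
    fderiv ℝ (fun z' => fderiv ℝ f z' (c z')) z w
      = fderiv ℝ (fderiv ℝ f) z w (c z) + fderiv ℝ f z (c' w) := by
  have h1 : HasFDerivAt (fderiv ℝ f) (fderiv ℝ (fderiv ℝ f) z) z :=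
    ((hf.fderiv_right (m := ∞) (by simp)).differentiableAt (by simp)).hasFDerivAt
  rw [(h1.clm_apply hc).fderiv]
  simp [add_comm]

lemma fderiv_fderiv_const {V H : Type*} [NormedAddCommGroup V] [NormedSpace ℝ V]
    [NormedAddCommGroup H] [NormedSpace ℝ H] {f : V → H} {z : V}
    (hf : ContDiffAt ℝ ∞ f z) (v w : V) :
    fderiv ℝ (fun z' => fderiv ℝ f z' v) z w = fderiv ℝ (fderiv ℝ f) z w v := by
  rw [fderiv_fderiv_apply hf (hasFDerivAt_const v z)]
  simp

lemma fderiv_fderiv_symm {V H : Type*} [NormedAddCommGroup V] [NormedSpace ℝ V]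
    [NormedAddCommGroup H] [NormedSpace ℝ H] {f : V → H} {z : V}
    (hf : ContDiffAt ℝ ∞ f z) (v w : V) :
    fderiv ℝ (fderiv ℝ f) z v w = fderiv ℝ (fderiv ℝ f) z w v :=
  (hf.isSymmSndFDerivAt (by simpa using ENat.LEInfty.out)).eq v w

/-- The direction of a spray with vertical component `s`. -/
lemma hasFDerivAt_snd_prodMk {s : E × E → E} {z : E × E} (hs : ContDiffAt ℝ ∞ s z) :
    HasFDerivAt (fun z' : E × E => (z'.2, s z'))
      ((ContinuousLinearMap.snd ℝ E E).prod (fderiv ℝ s z)) z :=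
  hasFDerivAt_snd.prodMk (hs.differentiableAt (by simp)).hasFDerivAt

lemma hasFDerivAt_zero_prodMk {s : E × E → E} {z : E × E} (hs : ContDiffAt ℝ ∞ s z) :
    HasFDerivAt (fun z' : E × E => ((0 : E), s z'))
      ((0 : E × E →L[ℝ] E).prod (fderiv ℝ s z)) z :=
  (hasFDerivAt_const _ _).prodMk (hs.differentiableAt (by simp)).hasFDerivAt

/-- A `2`-homogeneous energy `e` and a spray `(y, s)` solving its Euler-Lagrange equation. -/
structure EnergySpray (U : Set (E × E)) (e : E × E → ℝ) (s : E × E → E) : Prop where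
  isOpen : IsOpen U
  smooth_e : ∀ z ∈ U, ContDiffAt ℝ ∞ e z
  smooth_s : ∀ z ∈ U, ContDiffAt ℝ ∞ s z
  homog_e : ∀ z ∈ U, fderiv ℝ e z (0, z.2) = 2 * e z
  homog_s : ∀ z ∈ U, fderiv ℝ s z (0, z.2) = (2 : ℝ) • s z
  el : ∀ z ∈ U, ∀ a, fderiv ℝ (fderiv ℝ e) z (z.2, s z) (0, a) = fderiv ℝ e z (a, 0)

variable {U : Set (E × E)} {e : E × E → ℝ} {s : E × E → E}

lemma fderiv_eq_of_eqOn {V H : Type*} [NormedAddCommGroup V] [NormedSpace ℝ V]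
    [NormedAddCommGroup H] [NormedSpace ℝ H] {U : Set V} (hU : IsOpen U) {f g : V → H}
    (h : EqOn f g U) {z : V} (hz : z ∈ U) : fderiv ℝ f z = fderiv ℝ g z :=
  (h.eventuallyEq_of_mem (hU.mem_nhds hz)).fderiv_eq

lemma apply_pair (L : E × E →L[ℝ] ℝ) (a b : E) : L (a, b) = L (a, 0) + L (0, b) := by
  rw [← map_add]; simp

/-- The derivative of the relation of homogeneity of degree two. -/
lemma hess_vert_of_homog (hU : IsOpen U) {z : E × E} (hz : z ∈ U) (he : ContDiffAt ℝ ∞ e z)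
    (hh : ∀ z ∈ U, fderiv ℝ e z (0, z.2) = 2 * e z) (w : E × E) :
    fderiv ℝ (fderiv ℝ e) z w (0, z.2) + fderiv ℝ e z (0, w.2) = 2 * fderiv ℝ e z w := by
  have h1 := congrArg (fun T => T w) (fderiv_eq_of_eqOn hU
    (f := fun z' : E × E => fderiv ℝ e z' (0, z'.2)) (g := fun z' => 2 * e z') hh hz)
  have hc : HasFDerivAt (fun z' : E × E => ((0 : E), z'.2))
      ((0 : E × E →L[ℝ] E).prod (ContinuousLinearMap.snd ℝ E E)) z :=
    (hasFDerivAt_const _ _).prodMk hasFDerivAt_snd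
  have h2 := fderiv_fderiv_apply he hc w
  have h3 : fderiv ℝ (fun z' => 2 * e z') z w = 2 * fderiv ℝ e z w := by
    rw [fderiv_const_mul (he.differentiableAt (by simp))]; rfl
  rw [h2, h3] at h1
  exact h1

lemma EnergySpray.hess_vert (h : EnergySpray U e s) {z : E × E} (hz : z ∈ U) (w : E × E) :
    fderiv ℝ (fderiv ℝ e) z w (0, z.2) + fderiv ℝ e z (0, w.2) = 2 * fderiv ℝ e z w :=
  hess_vert_of_homog h.isOpen hz (h.smooth_e z hz) h.homog_e w

/-- Conservation of energy along the spray. -/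
lemma EnergySpray.conserve (h : EnergySpray U e s) {z : E × E} (hz : z ∈ U) :
    fderiv ℝ e z (z.2, s z) = 0 := by
  have h1 := h.hess_vert hz (z.2, s z)
  have h2 := h.el z hz z.2
  have h3 := apply_pair (fderiv ℝ e z) z.2 (s z)
  simp only at h1
  linarith

/-- The energy is constant along horizontal directions. -/
lemma EnergySpray.horiz (h : EnergySpray U e s) {z : E × E} (hz : z ∈ U) (a : E) :
    fderiv ℝ e z (a, (1 / 2 : ℝ) • fderiv ℝ s z (0, a)) = 0 := by
  have h1 := congrArg (fun T => T ((0 : E), a)) (fderiv_eq_of_eqOn h.isOpen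
    (f := fun z' : E × E => fderiv ℝ e z' (z'.2, s z')) (g := fun _ => (0 : ℝ))
    (fun z' hz' => h.conserve hz') hz)
  have h2 := fderiv_fderiv_apply (h.smooth_e z hz) (hasFDerivAt_snd_prodMk (h.smooth_s z hz)) (0, a)
  simp only [fderiv_fun_const, Pi.zero_apply, zero_apply] at h1
  rw [h2, fderiv_fderiv_symm (h.smooth_e z hz), h.el z hz] at h1
  simp only [ContinuousLinearMap.prod_apply, ContinuousLinearMap.coe_snd'] at h1
  rw [apply_pair _ a (fderiv ℝ s z (0, a))] at h1
  rw [apply_pair]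
  have h4 : ((0 : E), (1 / 2 : ℝ) • fderiv ℝ s z (0, a))
      = (1 / 2 : ℝ) • ((0 : E), fderiv ℝ s z (0, a)) := by simp
  rw [h4, map_smul, smul_eq_mul]
  linarith

/-- A concurrent field `p` with associated function `Φ = ∂e(p)`. -/
structure FlatConcurrent (U : Set (E × E)) (e : E × E → ℝ) (s : E × E → E) (p : E × E → E)
    (Φ : E × E → ℝ) : Prop extends EnergySpray U e s where
  smooth_p : ∀ z ∈ U, ContDiffAt ℝ ∞ p z
  Phi_eq : ∀ z ∈ U, Φ z = fderiv ℝ e z (0, p z)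
  vert_p : ∀ z ∈ U, ∀ a, fderiv ℝ p z (0, a) = 0
  berwald : ∀ z ∈ U, ∀ a, fderiv ℝ p z (a, (1 / 2 : ℝ) • fderiv ℝ s z (0, a))
    - (1 / 2 : ℝ) • fderiv ℝ (fderiv ℝ s) z (0, p z) (0, a) = -a

variable {p : E × E → E} {Φ : E × E → ℝ}

lemma FlatConcurrent.smooth_Phi (h : FlatConcurrent U e s p Φ) {z : E × E} (hz : z ∈ U) :
    ContDiffAt ℝ ∞ Φ z := by
  have h1 : ContDiffAt ℝ ∞ (fun z' => fderiv ℝ e z' (0, p z')) z :=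
    ((h.smooth_e z hz).fderiv_right (m := ∞) (by simp)).clm_apply
      (contDiffAt_const.prodMk (h.smooth_p z hz))
  exact h1.congr_of_eventuallyEq ((show EqOn Φ _ U from h.Phi_eq).eventuallyEq_of_mem
    (h.isOpen.mem_nhds hz))

lemma FlatConcurrent.fderiv_Phi (h : FlatConcurrent U e s p Φ) {z : E × E} (hz : z ∈ U)
    (v : E × E) : fderiv ℝ Φ z v
      = fderiv ℝ (fderiv ℝ e) z v (0, p z) + fderiv ℝ e z (0, fderiv ℝ p z v) := by
  rw [fderiv_eq_of_eqOn h.isOpen (show EqOn Φ _ U from h.Phi_eq) hz,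
    fderiv_fderiv_apply (h.smooth_e z hz) (hasFDerivAt_zero_prodMk (h.smooth_p z hz))]
  rfl

lemma FlatConcurrent.fderiv_Phi_vert (h : FlatConcurrent U e s p Φ) {z : E × E} (hz : z ∈ U)
    (a : E) : fderiv ℝ Φ z (0, a) = fderiv ℝ (fderiv ℝ e) z (0, a) (0, p z) := by
  rw [h.fderiv_Phi hz, h.vert_p z hz, Prod.mk_zero_zero, map_zero, add_zero]

lemma FlatConcurrent.homog_Phi (h : FlatConcurrent U e s p Φ) {z : E × E} (hz : z ∈ U) :
    fderiv ℝ Φ z (0, z.2) = Φ z := by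
  have h1 := h.hess_vert hz (0, p z)
  rw [h.fderiv_Phi_vert hz, fderiv_fderiv_symm (h.smooth_e z hz), h.Phi_eq z hz]
  simp only at h1
  linarith

lemma FlatConcurrent.horiz_Phi (h : FlatConcurrent U e s p Φ) {z : E × E} (hz : z ∈ U) (a : E) :
    fderiv ℝ Φ z (a, (1 / 2 : ℝ) • fderiv ℝ s z (0, a)) = - fderiv ℝ e z (0, a) := by
  have hc : HasFDerivAt (fun z' : E × E => (a, (1 / 2 : ℝ) • fderiv ℝ s z' (0, a)))
      ((0 : E × E →L[ℝ] E).prod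
        ((1 / 2 : ℝ) • fderiv ℝ (fun z' : E × E => fderiv ℝ s z' (0, a)) z)) z := by
    refine (hasFDerivAt_const _ _).prodMk (HasFDerivAt.const_smul ?_ _)
    exact ((((h.smooth_s z hz).fderiv_right (m := ∞) (by simp)).clm_apply
      contDiffAt_const).differentiableAt (by simp)).hasFDerivAt
  have h1 := congrArg (fun T => T ((0 : E), p z)) (fderiv_eq_of_eqOn h.isOpen
    (f := fun z' : E × E => fderiv ℝ e z' (a, (1 / 2 : ℝ) • fderiv ℝ s z' (0, a)))
    (g := fun _ => (0 : ℝ)) (fun z' hz' => h.horiz hz' a) hz)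
  have h2 := fderiv_fderiv_apply (h.smooth_e z hz) hc (0, p z)
  simp only [fderiv_fun_const, Pi.zero_apply, zero_apply] at h1
  rw [h2, fderiv_fderiv_symm (h.smooth_e z hz)] at h1
  simp only [ContinuousLinearMap.prod_apply, zero_apply,
    smul_apply] at h1
  rw [fderiv_fderiv_const (h.smooth_s z hz)] at h1
  have h3 := h.berwald z hz a
  rw [sub_eq_iff_eq_add] at h3
  rw [h.fderiv_Phi hz, h3]
  have h4 : ((0 : E), -a + (1 / 2 : ℝ) • fderiv ℝ (fderiv ℝ s) z (0, p z) (0, a))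
      = -((0 : E), a) + ((0 : E), (1 / 2 : ℝ) • fderiv ℝ (fderiv ℝ s) z (0, p z) (0, a)) := by simp
  rw [h4, map_add, map_neg]
  linarith

lemma FlatConcurrent.spray_Phi (h : FlatConcurrent U e s p Φ) {z : E × E} (hz : z ∈ U) :
    fderiv ℝ Φ z (z.2, s z) = - (2 * e z) := by
  have h1 := h.horiz_Phi hz z.2
  rw [h.homog_s z hz, h.homog_e z hz, smul_smul] at h1
  norm_num at h1
  linarith

/-- The function `Φ` satisfies the Euler-Lagrange equation along the spray of `e`. -/
lemma FlatConcurrent.el_Phi (h : FlatConcurrent U e s p Φ) {z : E × E} (hz : z ∈ U) (a : E) :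
    fderiv ℝ (fderiv ℝ Φ) z (z.2, s z) (0, a) = fderiv ℝ Φ z (a, 0) := by
  have h1 := congrArg (fun T => T ((0 : E), a)) (fderiv_eq_of_eqOn h.isOpen
    (f := fun z' : E × E => fderiv ℝ Φ z' (z'.2, s z')) (g := fun z' => -(2 * e z'))
    (fun z' hz' => h.spray_Phi hz') hz)
  have h2 := fderiv_fderiv_apply (h.smooth_Phi hz) (hasFDerivAt_snd_prodMk (h.smooth_s z hz)) (0, a)
  have h3 : fderiv ℝ (fun z' => -(2 * e z')) z (0, a) = -(2 * fderiv ℝ e z (0, a)) := by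
    rw [fderiv_fun_neg, fderiv_const_mul ((h.smooth_e z hz).differentiableAt (by simp))]; rfl
  rw [h2, h3, fderiv_fderiv_symm (h.smooth_Phi hz)] at h1
  simp only [ContinuousLinearMap.prod_apply, ContinuousLinearMap.coe_snd'] at h1
  have h4 := h.horiz_Phi hz a
  rw [apply_pair _ a (fderiv ℝ s z (0, a))] at h1
  rw [apply_pair] at h4
  have h5 : ((0 : E), (1 / 2 : ℝ) • fderiv ℝ s z (0, a))
      = (1 / 2 : ℝ) • ((0 : E), fderiv ℝ s z (0, a)) := by simp
  rw [h5, map_smul, smul_eq_mul] at h4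
  linarith

end Flat

end FlatEnergy

section FlatFinslerFunction

section Flat

variable {E : Type*} [NormedAddCommGroup E] [NormedSpace ℝ E]

/-- A Finsler function `F` with a concurrent field. -/
structure FlatFinsler (U : Set (E × E)) (F : E × E → ℝ) (s : E × E → E) (p : E × E → E)
    (Φ : E × E → ℝ) : Prop extends FlatConcurrent U (fun z => F z ^ 2 / 2) s p Φ where
  smooth_F : ∀ z ∈ U, ContDiffAt ℝ ∞ F z
  cartan : ∀ z ∈ U, ∀ a c, fderiv ℝ (fderiv ℝ Φ) z (0, c) (0, a) = 0
  pos_F : ∀ z ∈ U, 0 < F z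
  nondeg : ∀ z ∈ U, ∀ a, (∀ b, fderiv ℝ (fderiv ℝ (fun z => F z ^ 2 / 2)) z (0, a) (0, b) = 0) →
    a = 0

variable {U : Set (E × E)} {F : E × E → ℝ} {s : E × E → E} {p : E × E → E} {Φ : E × E → ℝ}

lemma fderiv_energy {z : E × E} (hF : ContDiffAt ℝ ∞ F z) (v : E × E) :
    fderiv ℝ (fun z => F z ^ 2 / 2) z v = F z * fderiv ℝ F z v := by
  have h1 := (hF.differentiableAt (by simp)).hasFDerivAt
  have h2 : HasFDerivAt (fun z => F z ^ 2 / 2) (F z • fderiv ℝ F z) z := by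
    have h3 : HasFDerivAt (fun z => (1 / 2 : ℝ) * (F z * F z)) _ z := (h1.mul h1).const_mul _
    refine (h3.congr_of_eventuallyEq (.of_forall fun z' => by ring)).congr_fderiv ?_
    ext w <;> simp <;> ring
  rw [h2.fderiv]
  rfl

lemma fderiv_fderiv_energy {z : E × E} (hF : ContDiffAt ℝ ∞ F z) (v w : E × E) :
    fderiv ℝ (fderiv ℝ (fun z => F z ^ 2 / 2)) z w v
      = fderiv ℝ F z w * fderiv ℝ F z v + F z * fderiv ℝ (fderiv ℝ F) z w v := by
  have he : ContDiffAt ℝ ∞ (fun z => F z ^ 2 / 2) z := (hF.pow 2).div_const 2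
  rw [← fderiv_fderiv_const he]
  have h0 : ∀ᶠ z' in 𝓝 z, ContDiffAt ℝ 1 F z' := (hF.of_le (by simp)).eventually (by simp)
  have h1 : (fun z' => fderiv ℝ (fun z => F z ^ 2 / 2) z' v) =ᶠ[𝓝 z]
      fun z' => F z' * fderiv ℝ F z' v := by
    filter_upwards [h0] with z' hz'
    have h1 := (hz'.differentiableAt (by simp)).hasFDerivAt
    have h2 : HasFDerivAt (fun z => F z ^ 2 / 2) (F z' • fderiv ℝ F z') z' := by
      have h3 : HasFDerivAt (fun z => (1 / 2 : ℝ) * (F z * F z)) _ z' := (h1.mul h1).const_mul _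
      refine (h3.congr_of_eventuallyEq (.of_forall fun z' => by ring)).congr_fderiv ?_
      ext w <;> simp <;> ring
    rw [h2.fderiv]
    rfl
  rw [h1.fderiv_eq]
  have h2 : DifferentiableAt ℝ (fun z' => fderiv ℝ F z' v) z :=
    ((hF.fderiv_right (m := ∞) (by simp)).clm_apply contDiffAt_const).differentiableAt (by simp)
  rw [fderiv_fun_mul (hF.differentiableAt (by simp)) h2]
  simp only [add_apply, smul_apply, smul_eq_mul]
  rw [fderiv_fderiv_const hF]
  ring

namespace FlatFinsler

lemma homog_F (h : FlatFinsler U F s p Φ) {z : E × E} (hz : z ∈ U) :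
    fderiv ℝ F z (0, z.2) = F z := by
  have h1 := h.homog_e z hz
  rw [fderiv_energy (h.smooth_F z hz)] at h1
  have := (h.pos_F z hz).ne'
  apply mul_left_cancel₀ this
  linarith

lemma conserve_F (h : FlatFinsler U F s p Φ) {z : E × E} (hz : z ∈ U) :
    fderiv ℝ F z (z.2, s z) = 0 := by
  have h1 := h.conserve hz
  rw [fderiv_energy (h.smooth_F z hz)] at h1
  exact (mul_eq_zero.1 h1).resolve_left (h.pos_F z hz).ne'

lemma el_F (h : FlatFinsler U F s p Φ) {z : E × E} (hz : z ∈ U) (a : E) :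
    fderiv ℝ (fderiv ℝ F) z (z.2, s z) (0, a) = fderiv ℝ F z (a, 0) := by
  have h1 := h.el z hz a
  rw [fderiv_energy (h.smooth_F z hz), fderiv_fderiv_energy (h.smooth_F z hz),
    h.conserve_F hz, zero_mul, zero_add] at h1
  exact mul_left_cancel₀ (h.pos_F z hz).ne' h1

lemma hess_F_self (h : FlatFinsler U F s p Φ) {z : E × E} (hz : z ∈ U) (w : E) :
    fderiv ℝ (fderiv ℝ F) z (0, w) (0, z.2) = 0 := by
  have h1 := h.hess_vert hz (0, w)
  rw [fderiv_energy (h.smooth_F z hz), fderiv_fderiv_energy (h.smooth_F z hz), h.homog_F hz] at h1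
  refine (mul_eq_zero.1 ?_).resolve_left (h.pos_F z hz).ne'
  simp only at h1
  linarith

lemma deriv_F_p (h : FlatFinsler U F s p Φ) {z : E × E} (hz : z ∈ U) :
    F z * fderiv ℝ F z (0, p z) = Φ z := by
  rw [h.Phi_eq z hz, fderiv_energy (h.smooth_F z hz)]

lemma hess_F_p (h : FlatFinsler U F s p Φ) {z : E × E} (hz : z ∈ U) (a : E) :
    fderiv ℝ F z (0, a) * fderiv ℝ F z (0, p z)
      + F z * fderiv ℝ (fderiv ℝ F) z (0, a) (0, p z) = fderiv ℝ Φ z (0, a) := by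
  rw [h.fderiv_Phi_vert hz, fderiv_fderiv_energy (h.smooth_F z hz)]

end FlatFinsler

/-- The algebra of the equation determining the spray of `F² / (F - Φ)`. -/
lemma matsumoto_linear_system {F Φ P Δ lt bt : ℝ} (hF : 0 < F) (hq : Φ < F)
    (hr : F - 2 * Φ ≠ 0) (hΔ : Δ = F * (1 + 2 * P) - 3 * Φ) (hΔ0 : Δ ≠ 0)
    (h1 : ((F ^ 2 - 4 * F * Φ + 6 * Φ ^ 2) * lt + F * (F - 4 * Φ) * bt) * F
      + (F * (F - 4 * Φ) * lt + 3 * F ^ 2 * bt) * Φ = 0)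
    (h2 : F * (((F ^ 2 - 4 * F * Φ + 6 * Φ ^ 2) * lt + F * (F - 4 * Φ) * bt) * (Φ / F)
      + F * (F - Φ) * (F - 2 * Φ) * ((bt - Φ / F * lt) / F)
      + (F * (F - 4 * Φ) * lt + 3 * F ^ 2 * bt) * P) = 0) : lt = 0 ∧ bt = 0 := by
  have hF0 := hF.ne'
  have hq0 : F - Φ ≠ 0 := (sub_pos.2 hq).ne'
  have e1 : (F - 2 * Φ) * lt + F * bt = 0 := by
    have : F * (F - Φ) * ((F - 2 * Φ) * lt + F * bt) = 0 := by linear_combination h1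
    exact (mul_eq_zero.1 this).resolve_left (mul_ne_zero hF0 hq0)
  have e2 : ((F ^ 2 - 4 * F * Φ + 6 * Φ ^ 2) * lt + F * (F - 4 * Φ) * bt) * Φ
      + (F - Φ) * (F - 2 * Φ) * (F * bt - Φ * lt)
      + F * (F * (F - 4 * Φ) * lt + 3 * F ^ 2 * bt) * P = 0 := by
    field_simp at h2
    linear_combination h2
  have e3 : F ^ 2 * (F - Φ) * Δ * bt = 0 := by
    rw [hΔ]
    linear_combination (F - 2 * Φ) * e2 - ((F ^ 2 - 4 * F * Φ + 6 * Φ ^ 2) * Φ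
      - (F - Φ) * (F - 2 * Φ) * Φ + F * (F * (F - 4 * Φ)) * P) * e1
  have hbt : bt = 0 := (mul_eq_zero.1 e3).resolve_left
    (mul_ne_zero (mul_ne_zero (pow_ne_zero 2 hF0) hq0) hΔ0)
  refine ⟨?_, hbt⟩
  rw [hbt, mul_zero, add_zero] at e1
  exact (mul_eq_zero.1 e1).resolve_left hr

lemma matsumoto_correction {F Φ P Δ f₁ f₂ La ba lt bt mt lw bw mw : ℝ} (hF : 0 < F)
    (hΔ : Δ = F * (1 + 2 * P) - 3 * Φ) (hΔ0 : Δ ≠ 0)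
    (hf₁ : f₁ = F * (4 * Φ - F) / Δ) (hf₂ : f₂ = 2 * F ^ 3 / Δ)
    (hlw : lw = lt - f₁ * F + f₂ * (Φ / F)) (hbw : bw = bt - f₁ * Φ + f₂ * P)
    (hmw : mw = mt + f₂ * ((ba - Φ / F * La) / F))
    (h : ((F ^ 2 - 4 * F * Φ + 6 * Φ ^ 2) * lw + F * (F - 4 * Φ) * bw) * La
      + F * (F - Φ) * (F - 2 * Φ) * mw
      + (F * (F - 4 * Φ) * lw + 3 * F ^ 2 * bw) * ba
      = F ^ 2 * (F * (F - 4 * Φ) * La + 3 * F ^ 2 * ba)) :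
    ((F ^ 2 - 4 * F * Φ + 6 * Φ ^ 2) * lt + F * (F - 4 * Φ) * bt) * La
      + F * (F - Φ) * (F - 2 * Φ) * mt
      + (F * (F - 4 * Φ) * lt + 3 * F ^ 2 * bt) * ba = 0 := by
  have hF0 := hF.ne'
  have e : ((F ^ 2 - 4 * F * Φ + 6 * Φ ^ 2) * (- f₁ * F + f₂ * (Φ / F))
        + F * (F - 4 * Φ) * (- f₁ * Φ + f₂ * P)) * La
      + F * (F - Φ) * (F - 2 * Φ) * (f₂ * ((ba - Φ / F * La) / F))
      + (F * (F - 4 * Φ) * (- f₁ * F + f₂ * (Φ / F)) + 3 * F ^ 2 * (- f₁ * Φ + f₂ * P)) * ba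
      = F ^ 2 * (F * (F - 4 * Φ) * La + 3 * F ^ 2 * ba) := by
    rw [hf₁, hf₂]
    field_simp
    rw [hΔ]
    ring
  rw [hlw, hbw, hmw] at h
  linear_combination h - e

/-- Derivatives of functions of `(F, Φ)`, reduced to derivatives along lines. -/
lemma fderiv_apply_of_line {f : E × E → ℝ} {z v : E × E} {d : ℝ} (hf : DifferentiableAt ℝ f z)
    (h : HasDerivAt (fun t : ℝ => f (z + t • v)) d 0) : fderiv ℝ f z v = d :=
  (hf.hasFDerivAt.hasLineDerivAt v).unique h

lemma hasDerivAt_line {f : E × E → ℝ} {z : E × E} (hf : DifferentiableAt ℝ f z) (v : E × E) :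
    HasDerivAt (fun t : ℝ => f (z + t • v)) (fderiv ℝ f z v) 0 :=
  hf.hasFDerivAt.hasLineDerivAt v

lemma fderiv_matsumoto_energy {z : E × E} (hF : DifferentiableAt ℝ F z)
    (hΦ : DifferentiableAt ℝ Φ z) (hq : Φ z < F z) (v : E × E) :
    fderiv ℝ (fun z => (F z ^ 2 / (F z - Φ z)) ^ 2 / 2) z v
      = F z ^ 3 * (F z - 2 * Φ z) / (F z - Φ z) ^ 3 * fderiv ℝ F z v
        + F z ^ 4 / (F z - Φ z) ^ 3 * fderiv ℝ Φ z v := by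
  have hq0 : F z - Φ z ≠ 0 := (sub_pos.2 hq).ne'
  refine fderiv_apply_of_line ?_ ?_
  · fun_prop (disch := assumption)
  · have hx := hasDerivAt_line hF v
    have hy := hasDerivAt_line hΦ v
    have hq1 : F (z + (0 : ℝ) • v) - Φ (z + (0 : ℝ) • v) ≠ 0 := by simpa using hq0
    refine ((((hx.fun_pow 2).fun_div (hx.fun_sub hy) hq1).fun_pow 2).div_const 2).congr_deriv ?_
    simp only [zero_smul, add_zero, Nat.cast_ofNat, Nat.add_one_sub_one]
    field_simp
    ring

lemma fderiv_coeff_F {z : E × E} (hF : DifferentiableAt ℝ F z)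
    (hΦ : DifferentiableAt ℝ Φ z) (hq : Φ z < F z) (v : E × E) :
    fderiv ℝ (fun z => F z ^ 3 * (F z - 2 * Φ z) / (F z - Φ z) ^ 3) z v
      = F z ^ 2 / (F z - Φ z) ^ 4 * ((F z ^ 2 - 4 * F z * Φ z + 6 * Φ z ^ 2) * fderiv ℝ F z v
        + F z * (F z - 4 * Φ z) * fderiv ℝ Φ z v) := by
  have hq0 : F z - Φ z ≠ 0 := (sub_pos.2 hq).ne'
  refine fderiv_apply_of_line ?_ ?_
  · fun_prop (disch := simpa using hq0)
  · have hx := hasDerivAt_line hF v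
    have hy := hasDerivAt_line hΦ v
    have hq1 : (F (z + (0 : ℝ) • v) - Φ (z + (0 : ℝ) • v)) ^ 3 ≠ 0 := by simpa using hq0
    refine (((hx.fun_pow 3).fun_mul (hx.fun_sub (hy.const_mul 2))).fun_div
      ((hx.fun_sub hy).fun_pow 3) hq1).congr_deriv ?_
    simp only [zero_smul, add_zero, Nat.cast_ofNat, Nat.add_one_sub_one]
    field_simp
    ring

lemma fderiv_coeff_Phi {z : E × E} (hF : DifferentiableAt ℝ F z)
    (hΦ : DifferentiableAt ℝ Φ z) (hq : Φ z < F z) (v : E × E) :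
    fderiv ℝ (fun z => F z ^ 4 / (F z - Φ z) ^ 3) z v
      = F z ^ 2 / (F z - Φ z) ^ 4 * (F z * (F z - 4 * Φ z) * fderiv ℝ F z v
        + 3 * F z ^ 2 * fderiv ℝ Φ z v) := by
  have hq0 : F z - Φ z ≠ 0 := (sub_pos.2 hq).ne'
  refine fderiv_apply_of_line ?_ ?_
  · fun_prop (disch := simpa using hq0)
  · have hx := hasDerivAt_line hF v
    have hy := hasDerivAt_line hΦ v
    have hq1 : (F (z + (0 : ℝ) • v) - Φ (z + (0 : ℝ) • v)) ^ 3 ≠ 0 := by simpa using hq0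
    refine ((hx.fun_pow 4).fun_div ((hx.fun_sub hy).fun_pow 3) hq1).congr_deriv ?_
    simp only [zero_smul, add_zero, Nat.cast_ofNat, Nat.add_one_sub_one]
    field_simp
    ring

/-- The Hessian of the energy of `F² / (F - Φ)`. -/
lemma hess_matsumoto_energy {z : E × E} (hF : ContDiffAt ℝ ∞ F z) (hΦ : ContDiffAt ℝ ∞ Φ z)
    (hq : Φ z < F z) (v w : E × E) :
    fderiv ℝ (fun z' => fderiv ℝ (fun z => (F z ^ 2 / (F z - Φ z)) ^ 2 / 2) z' v) z w
      = F z ^ 2 / (F z - Φ z) ^ 4 * (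
        ((F z ^ 2 - 4 * F z * Φ z + 6 * Φ z ^ 2) * fderiv ℝ F z w
          + F z * (F z - 4 * Φ z) * fderiv ℝ Φ z w) * fderiv ℝ F z v
        + F z * (F z - Φ z) * (F z - 2 * Φ z) * fderiv ℝ (fderiv ℝ F) z w v
        + (F z * (F z - 4 * Φ z) * fderiv ℝ F z w
          + 3 * F z ^ 2 * fderiv ℝ Φ z w) * fderiv ℝ Φ z v
        + F z ^ 2 * (F z - Φ z) * fderiv ℝ (fderiv ℝ Φ) z w v) := by
  have hq0 : F z - Φ z ≠ 0 := (sub_pos.2 hq).ne'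
  have h1 : ∀ᶠ z' in 𝓝 z, ContDiffAt ℝ 1 F z' := (hF.of_le (by simp)).eventually (by simp)
  have h2 : ∀ᶠ z' in 𝓝 z, ContDiffAt ℝ 1 Φ z' := (hΦ.of_le (by simp)).eventually (by simp)
  have h3 : ∀ᶠ z' in 𝓝 z, Φ z' < F z' :=
    hΦ.continuousAt.eventually_lt hF.continuousAt hq
  have h4 : (fun z' => fderiv ℝ (fun z => (F z ^ 2 / (F z - Φ z)) ^ 2 / 2) z' v) =ᶠ[𝓝 z] fun z' =>
      F z' ^ 3 * (F z' - 2 * Φ z') / (F z' - Φ z') ^ 3 * fderiv ℝ F z' v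
        + F z' ^ 4 / (F z' - Φ z') ^ 3 * fderiv ℝ Φ z' v := by
    filter_upwards [h1, h2, h3] with z' e1 e2 e3
    exact fderiv_matsumoto_energy (e1.differentiableAt (by simp)) (e2.differentiableAt (by simp)) e3 v
  have dF := hF.differentiableAt (by simp)
  have dΦ := hΦ.differentiableAt (by simp)
  have dA : DifferentiableAt ℝ (fun z => F z ^ 3 * (F z - 2 * Φ z) / (F z - Φ z) ^ 3) z := by
    fun_prop (disch := simpa using hq0)
  have dB : DifferentiableAt ℝ (fun z => F z ^ 4 / (F z - Φ z) ^ 3) z := by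
    fun_prop (disch := simpa using hq0)
  have dFv : DifferentiableAt ℝ (fun z' => fderiv ℝ F z' v) z :=
    ((hF.fderiv_right (m := ∞) (by simp)).clm_apply contDiffAt_const).differentiableAt (by simp)
  have dΦv : DifferentiableAt ℝ (fun z' => fderiv ℝ Φ z' v) z :=
    ((hΦ.fderiv_right (m := ∞) (by simp)).clm_apply contDiffAt_const).differentiableAt (by simp)
  rw [h4.fderiv_eq, fderiv_fun_add (dA.fun_mul dFv) (dB.fun_mul dΦv), fderiv_fun_mul dA dFv,
    fderiv_fun_mul dB dΦv]
  simp only [add_apply, smul_apply, smul_eq_mul]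
  rw [fderiv_coeff_F dF dΦ hq, fderiv_coeff_Phi dF dΦ hq, fderiv_fderiv_const hF,
    fderiv_fderiv_const hΦ]
  field_simp
  ring

end Flat

end FlatFinslerFunction

section FlatMatsumoto

section Flat

variable {E : Type*} [NormedAddCommGroup E] [NormedSpace ℝ E]
variable {U : Set (E × E)} {F : E × E → ℝ} {s : E × E → E} {p : E × E → E} {Φ : E × E → ℝ}

/-- The function `F (1 + 2 p²) - 3 Φ`. -/
def flatDelta (F Φ : E × E → ℝ) (p : E × E → E) (z : E × E) : ℝ :=
  F z * (1 + 2 * fderiv ℝ Φ z (0, p z)) - 3 * Φ z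

/-- The function `F (4 Φ - F) / (F (1 + 2 p²) - 3 Φ)`. -/
def flatf₁ (F Φ : E × E → ℝ) (p : E × E → E) (z : E × E) : ℝ :=
  F z * (4 * Φ z - F z) / flatDelta F Φ p z

/-- The function `2 F³ / (F (1 + 2 p²) - 3 Φ)`. -/
def flatf₂ (F Φ : E × E → ℝ) (p : E × E → E) (z : E × E) : ℝ :=
  2 * F z ^ 3 / flatDelta F Φ p z

namespace FlatFinsler

lemma contDiffAt_flatDelta (h : FlatFinsler U F s p Φ) {z : E × E} (hz : z ∈ U) :
    ContDiffAt ℝ ∞ (flatDelta F Φ p) z := by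
  have h1 : ContDiffAt ℝ ∞ (fun z' => fderiv ℝ Φ z' (0, p z')) z :=
    ((h.smooth_Phi hz).fderiv_right (m := ∞) (by simp)).clm_apply
      (contDiffAt_const.prodMk (h.smooth_p z hz))
  exact ((h.smooth_F z hz).mul (contDiffAt_const.add (contDiffAt_const.mul h1))).sub
    (contDiffAt_const.mul (h.smooth_Phi hz))

lemma contDiffAt_flatf₁ (h : FlatFinsler U F s p Φ) {z : E × E} (hz : z ∈ U)
    (hΔ : flatDelta F Φ p z ≠ 0) : ContDiffAt ℝ ∞ (flatf₁ F Φ p) z :=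
  ((h.smooth_F z hz).mul ((contDiffAt_const.mul (h.smooth_Phi hz)).sub (h.smooth_F z hz))).div
    (h.contDiffAt_flatDelta hz) hΔ

lemma contDiffAt_flatf₂ (h : FlatFinsler U F s p Φ) {z : E × E} (hz : z ∈ U)
    (hΔ : flatDelta F Φ p z ≠ 0) : ContDiffAt ℝ ∞ (flatf₂ F Φ p) z :=
  (contDiffAt_const.mul ((h.smooth_F z hz).pow 3)).div (h.contDiffAt_flatDelta hz) hΔ

/-- Pointwise uniqueness of the spray of `F² / (F - Φ)` where `F ≠ 2 Φ`. -/
lemma spray_eq_of_ne (h : FlatFinsler U F s p Φ) {z : E × E} (hz : z ∈ U) (hq : Φ z < F z)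
    (hΔ : flatDelta F Φ p z ≠ 0) (hr : F z - 2 * Φ z ≠ 0) {s' : E}
    (hel : ∀ a, fderiv ℝ (fun z' => fderiv ℝ (fun z => (F z ^ 2 / (F z - Φ z)) ^ 2 / 2) z' (0, a))
      z (z.2, s') = fderiv ℝ (fun z => (F z ^ 2 / (F z - Φ z)) ^ 2 / 2) z (a, 0)) :
    s' = s z - flatf₁ F Φ p z • z.2 + flatf₂ F Φ p z • p z := by
  have hF0 := (h.pos_F z hz).ne'
  have hq0 : F z - Φ z ≠ 0 := (sub_pos.2 hq).ne'
  have sF := h.smooth_F z hz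
  have sΦ := h.smooth_Phi hz
  set t : E := s' - s z + flatf₁ F Φ p z • z.2 - flatf₂ F Φ p z • p z with ht
  set c₁ := flatf₁ F Φ p z with hc₁
  set c₂ := flatf₂ F Φ p z with hc₂
  have hlp : fderiv ℝ F z (0, p z) = Φ z / F z := by
    rw [eq_div_iff hF0, mul_comm]; exact h.deriv_F_p hz
  have hmp : ∀ a, fderiv ℝ (fderiv ℝ F) z (0, p z) (0, a)
      = (fderiv ℝ Φ z (0, a) - Φ z / F z * fderiv ℝ F z (0, a)) / F z := by
    intro a
    rw [fderiv_fderiv_symm sF, eq_div_iff hF0, ← hlp, ← h.hess_F_p hz]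
    ring
  have hmy : ∀ a, fderiv ℝ (fderiv ℝ F) z (0, z.2) (0, a) = 0 := by
    intro a
    rw [fderiv_fderiv_symm sF, h.hess_F_self hz]
  have hv : ((z.2, s') : E × E)
      = (z.2, s z) + (((0 : E), t) - c₁ • ((0 : E), z.2) + c₂ • ((0 : E), p z)) := by
    refine Prod.ext ?_ ?_
    · simp
    · simp only [ht, Prod.snd_add, Prod.snd_sub, Prod.smul_snd]
      abel
  have key : ∀ a, ((F z ^ 2 - 4 * F z * Φ z + 6 * Φ z ^ 2) * fderiv ℝ F z (0, t)
        + F z * (F z - 4 * Φ z) * fderiv ℝ Φ z (0, t)) * fderiv ℝ F z (0, a)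
      + F z * (F z - Φ z) * (F z - 2 * Φ z) * fderiv ℝ (fderiv ℝ F) z (0, t) (0, a)
      + (F z * (F z - 4 * Φ z) * fderiv ℝ F z (0, t) + 3 * F z ^ 2 * fderiv ℝ Φ z (0, t))
        * fderiv ℝ Φ z (0, a) = 0 := by
    intro a
    have e1 := hel a
    rw [hess_matsumoto_energy sF sΦ hq, fderiv_matsumoto_energy (sF.differentiableAt (by simp))
      (sΦ.differentiableAt (by simp)) hq, hv] at e1
    simp only [map_add, map_sub, map_smul, add_apply, sub_apply, smul_apply, smul_eq_mul] at e1
    rw [h.conserve_F hz, h.spray_Phi hz, h.el_F hz, h.el_Phi hz, hmy, hmp, h.homog_F hz, hlp,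
      h.homog_Phi hz, h.cartan z hz, h.cartan z hz, h.cartan z hz] at e1
    refine matsumoto_correction (h.pos_F z hz) (P := fderiv ℝ Φ z (0, p z)) (Δ := flatDelta F Φ p z)
      rfl hΔ hc₁ hc₂ rfl rfl rfl ?_
    field_simp at e1 ⊢
    linear_combination e1
  have k1 := key z.2
  have k2 := key (p z)
  rw [h.hess_F_self hz, h.homog_F hz, h.homog_Phi hz] at k1
  rw [fderiv_fderiv_symm sF, hmp, hlp] at k2
  obtain ⟨hlt, hbt⟩ := matsumoto_linear_system (h.pos_F z hz) hq hr
    (lt := fderiv ℝ F z (0, t)) (bt := fderiv ℝ Φ z (0, t)) (P := fderiv ℝ Φ z (0, p z)) (Δ := flatDelta F Φ p z) rfl hΔ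
    (by linear_combination k1) (by rw [k2, mul_zero])
  have ht0 : t = 0 := by
    refine h.nondeg z hz t fun b => ?_
    have k3 := key b
    rw [hlt, hbt] at k3
    simp only [mul_zero, add_zero, zero_mul, zero_add] at k3
    rw [fderiv_fderiv_energy sF, hlt, (mul_eq_zero.1 k3).resolve_left
      (mul_ne_zero (mul_ne_zero hF0 hq0) hr)]
    ring
  rw [ht] at ht0
  have : s' = s z - c₁ • z.2 + c₂ • p z + (s' - s z + c₁ • z.2 - c₂ • p z) := by abel
  rw [this, ht0, add_zero]

/-- The spray of `F² / (F - Φ)`. -/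
theorem spray_eq (h : FlatFinsler U F s p Φ) {U' : Set (E × E)} (hU' : IsOpen U') (hsub : U' ⊆ U)
    (hq : ∀ z ∈ U', Φ z < F z) (hΔ : ∀ z ∈ U', flatDelta F Φ p z ≠ 0) {s' : E × E → E}
    (hs' : ∀ z ∈ U', ContinuousAt s' z)
    (hel : ∀ z ∈ U', ∀ a,
      fderiv ℝ (fun z' => fderiv ℝ (fun z => (F z ^ 2 / (F z - Φ z)) ^ 2 / 2) z' (0, a))
      z (z.2, s' z) = fderiv ℝ (fun z => (F z ^ 2 / (F z - Φ z)) ^ 2 / 2) z (a, 0))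
    {z : E × E} (hz : z ∈ U') :
    s' z = s z - flatf₁ F Φ p z • z.2 + flatf₂ F Φ p z • p z := by
  by_contra hne
  have hzU := hsub hz
  have hcont : ContinuousAt (fun z => s z - flatf₁ F Φ p z • z.2 + flatf₂ F Φ p z • p z) z :=
    ((h.smooth_s z hzU).continuousAt.sub ((h.contDiffAt_flatf₁ hzU (hΔ z hz)).continuousAt.smul
      continuousAt_snd)).add ((h.contDiffAt_flatf₂ hzU (hΔ z hz)).continuousAt.smul
      (h.smooth_p z hzU).continuousAt)
  have h1 : ∀ᶠ z' in 𝓝 z, s' z' ≠ s z' - flatf₁ F Φ p z' • z'.2 + flatf₂ F Φ p z' • p z' :=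
    (((hs' z hz).sub hcont).eventually_ne (sub_ne_zero.2 hne)).mono fun _ => sub_ne_zero.1
  have h2 : F =ᶠ[𝓝 z] fun z' => 2 * Φ z' := by
    filter_upwards [h1, hU'.mem_nhds hz] with z' hz1 hz2
    by_contra h3
    exact hz1 (h.spray_eq_of_ne (hsub hz2) (hq z' hz2) (hΔ z' hz2) (sub_ne_zero.2 h3) (hel z' hz2))
  have h3 := congrArg (fun T => T (z.2, s z)) (h2.fderiv_eq (𝕜 := ℝ))
  have h4 : fderiv ℝ (fun z' => 2 * Φ z') z (z.2, s z) = 2 * fderiv ℝ Φ z (z.2, s z) := by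
    rw [fderiv_const_mul ((h.smooth_Phi hzU).differentiableAt (by simp))]; rfl
  rw [h4, h.conserve_F hzU, h.spray_Phi hzU] at h3
  have := h.pos_F z hzU
  nlinarith

end FlatFinsler

end Flat

end FlatMatsumoto

section HorizontalLift

variable {U : Set (TM n M)} {G : VField n M} {x : M}
  {z : EuclideanSpace ℝ (Fin n) × EuclideanSpace ℝ (Fin n)}

/-- A point and tangent vector extend to a smooth vector field on `M`, pulled back to a
`π`-vector field. -/
lemma exists_basic_field [T2Space M] (q : M) (v : TangentSpace (𝓡 n) q) :
    ∃ Y : (q : M) → TangentSpace (𝓡 n) q, Y q = v ∧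
      PiSmooth (n := n) univ (fun u : TM n M => Y u.proj) := by
  obtain ⟨s, hs, hY⟩ := FiberBundle.exists_contMDiffOn_extend (k := ∞) (𝓡 n) 𝔼 v
  obtain ⟨t, hts, ht, hqt⟩ := mem_nhds_iff.1 hs
  obtain ⟨f, -, hf⟩ := (SmoothBumpFunction.nhds_basis_tsupport (I := 𝓡 n) q).mem_iff.1
    (ht.mem_nhds hqt)
  have h1 := ContMDiffOn.smul_section_of_tsupport (n := ∞) (f.contMDiff.contMDiffOn (s := t)) ht hf
    (hY.mono hts)
  refine ⟨(f : M → ℝ) • FiberBundle.extend 𝔼 v, ?_, ?_⟩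
  · simp
  · exact (h1.comp (contMDiff_proj (TangentSpace (𝓡 n)))).contMDiffOn

lemma fderiv_repP_basic (Y : (q : M) → TangentSpace (𝓡 n) q)
    (hY : DifferentiableAt ℝ (repP x (fun u : TM n M => Y u.proj)) z) (c : 𝔼) :
    fderiv ℝ (repP x (fun u : TM n M => Y u.proj)) z (0, c) = 0 := by
  have h1 := hY.hasFDerivAt.hasLineDerivAt ((0 : 𝔼), c)
  have h2 : (fun t : ℝ => repP x (fun u : TM n M => Y u.proj) (z + t • ((0 : 𝔼), c)))
      = fun _ => repP x (fun u : TM n M => Y u.proj) z := by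
    funext t
    have : z + t • ((0 : 𝔼), c) = (z.1, z.2 + t • c) := by ext <;> simp
    rw [this]
    rfl
  rw [HasLineDerivAt, h2] at h1
  exact h1.unique (hasDerivAt_const _ _)

lemma PiSmoothAt.gamF {X : PiField n M} (h : z ∈ (ch x).target) (hX : PiSmoothAt X (par x z)) :
    VSmoothAt (gamF X) (par x z) := by
  have h1 : ContDiffAt ℝ ∞ (fun z' => ((0, FinslerGeom.repP x X z') : 𝔼 × 𝔼)) z :=
    contDiffAt_const.prodMk (hX.repP h)
  refine VSmoothAt_of_rep h (h1.congr_of_eventuallyEq ?_)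
  filter_upwards [eventually_mem_target h] with z' hz'
  exact rep_gamF hz' X

lemma VSmoothAt.br {V W : VField n M} {u : TM n M} (hV : VSmoothAt V u) (hW : VSmoothAt W u) :
    VSmoothAt (br V W) u := by
  have : IsManifold (𝓡 n).tangent (((⊤ : ℕ∞) : ℕ∞ω) + 1) (TM n M) :=
    inferInstanceAs (IsManifold (𝓡 n).tangent ∞ (TM n M))
  exact ContMDiffAt.mlieBracket_vectorField (I := (𝓡 n).tangent) (m := ⊤) (n := ⊤) hV hW (by simp)

lemma exists_par (u : TM n M) : ∃ (x : M) (z : 𝔼 × 𝔼), z ∈ (ch (n := n) x).target ∧ par x z = u :=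
  ⟨u.proj, ch u.proj u, (ch u.proj).map_source (mem_ch_source u), par_ch (mem_ch_source u)⟩

/-- The horizontal lift of a `π`-vector field, through local smooth lifts. -/
def horLift (G : VField n M) (X : PiField n M) : VField n M := fun u =>
  hProj G (ofRep u.proj (fun z => (repP u.proj X z, 0))) u

lemma horLift_apply (G : VField n M) (X : PiField n M) (u : TM n M) : horLift G X u
    = hProj G (ofRep u.proj (fun z => (repP u.proj X z, 0))) u := rfl

lemma rep_congr {V W : VField n M} (hVW : V (par x z) = W (par x z)) : rep x V z = rep x W z := by
  rw [rep, rep, hVW]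

lemma rep_horLift (hG : IsSemispray U G) (h : z ∈ (ch x).target) (hu : par x z ∈ U)
    {X : PiField n M} (hX : PiSmooth U X) :
    rep x (horLift G X) z
      = (repP x X z, (1 / 2 : ℝ) • fderiv ℝ (spr x G) z (0, repP x X z)) := by
  set u := par x z with hu'
  set W := ofRep u.proj (fun z => (repP u.proj X z, (0 : 𝔼))) with hW
  have hs := mem_ch_source u
  have ht := (ch u.proj).map_source hs
  have hpu := par_ch hs
  have hXu : PiSmoothAt X (par u.proj (ch u.proj u)) := by
    rw [hpu]; exact hX.at hG.isOpen hu
  have hWs : VSmoothAt W u := vSmoothAt_ofRep hs ((hXu.repP ht).prodMk contDiffAt_const)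
  have h1 : rho u (W u) = X u := by
    have h2 := rho_rep ht W
    rw [hW, rep_ofRep ht, ← hW, lin_repP ht, hpu] at h2
    exact h2
  have h3 : (rep x W z).1 = repP x X z := by
    rw [← repP_rhoF h W]
    exact congrArg (linInv x (par x z).proj) h1
  have h4 : rep x (horLift G X) z = rep x (hProj G W) z := rep_congr (horLift_apply G X u)
  rw [h4, rep_hProj hG h hu hWs, h3]

lemma vSmooth_horLift (hG : IsSemispray U G) {X : PiField n M} (hX : PiSmooth U X) :
    VSmooth U (horLift G X) := by
  intro u hu
  obtain ⟨x, z, h, rfl⟩ := exists_par u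
  have hX1 := (hX.at hG.isOpen hu).repP h
  have hsp : ContDiffAt ℝ ∞ (fderiv ℝ (spr x G)) z :=
    (hG.contDiffAt_spr h hu).fderiv_right (by simp)
  have h1 : ContDiffAt ℝ ∞ (fun z' => ((repP x X z', (1 / 2 : ℝ) •
      fderiv ℝ (spr x G) z' (0, repP x X z')) : 𝔼 × 𝔼)) z :=
    hX1.prodMk ((hsp.clm_apply (contDiffAt_const.prodMk hX1)).const_smul (1 / 2 : ℝ))
  have h2 : VSmoothAt (horLift G X) (par x z) := by
    refine VSmoothAt_of_rep h (h1.congr_of_eventuallyEq ?_)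
    filter_upwards [eventually_par_mem hG.isOpen h hu] with z' hz'
    exact rep_horLift hG hz'.1 hz'.2 hX
  exact ContMDiffAt.contMDiffWithinAt h2

lemma beta_spec (hG : IsSemispray (slit n M) G) {X : PiField n M} (hX : PiSmooth (slit n M) X) :
    VSmooth (slit n M) (beta G X) ∧
      ∀ u ∈ slit n M, rho u (beta G X u) = X u ∧ vProj G (beta G X) u = 0 := by
  refine Classical.epsilon_spec (p := fun B : VField n M =>
    VSmooth (slit n M) B ∧ ∀ u ∈ slit n M, rho u (B u) = X u ∧ vProj G B u = 0)
    ⟨horLift G X, vSmooth_horLift hG hX, fun u hu => ?_⟩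
  obtain ⟨x, z, h, rfl⟩ := exists_par u
  have hr := rep_horLift hG h hu hX
  constructor
  · rw [rho_rep h, hr, lin_repP h]
  · have h1 := rep_vProj hG h hu ((vSmooth_horLift hG hX).at hG.isOpen hu)
    rw [hr, sub_self, rep_eq_iff h, Prod.mk_zero_zero, map_zero] at h1
    exact h1

lemma rep_beta (hG : IsSemispray (slit n M) G) {X : PiField n M} (hX : PiSmooth (slit n M) X)
    (h : z ∈ (ch x).target) (hu : par x z ∈ slit n M) :
    rep x (beta G X) z
      = (repP x X z, (1 / 2 : ℝ) • fderiv ℝ (spr x G) z (0, repP x X z)) := by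
  obtain ⟨h1, h2⟩ := beta_spec hG hX
  obtain ⟨h3, h4⟩ := h2 _ hu
  have h5 : (rep x (beta G X) z).1 = repP x X z := by
    rw [← repP_rhoF h]
    exact congrArg (linInv x (par x z).proj) h3
  have h6 := rep_vProj hG h hu (h1.at hG.isOpen hu)
  have h7 : rep x (vProj G (beta G X)) z = 0 := by
    rw [rep_eq_iff h, h4, map_zero]
  rw [h7] at h6
  have h8 := congrArg Prod.snd h6
  refine Prod.ext h5 ?_
  rw [h5] at h8
  exact (sub_eq_zero.1 h8.symm)

end HorizontalLift

section EulerLagrange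

variable {U : Set (TM n M)} {G : VField n M} {x : M}
  {z : EuclideanSpace ℝ (Fin n) × EuclideanSpace ℝ (Fin n)}

/-- The coordinate image of a subset of `TM`. -/
def chartSet (x : M) (U : Set (TM n M)) : Set (𝔼 × 𝔼) := {z | z ∈ (ch x).target ∧ par x z ∈ U}

lemma isOpen_chartSet (hU : IsOpen U) : IsOpen (chartSet x U) :=
  isOpen_iff_mem_nhds.2 fun _ hz => eventually_par_mem hU hz.1 hz.2

lemma dJ_rep (h : z ∈ (ch x).target) (f : TM n M → ℝ) (W : VField n M) :
    dJ f (par x z) (W (par x z)) = fderiv ℝ (f ∘ par x) z (0, (rep x W z).1) := by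
  rw [← rep_JF h W, ← dFun_rep h f (JF W)]
  rfl

lemma dFun_dJ_rep (h : z ∈ (ch x).target) (f : TM n M → ℝ) (V W : VField n M) :
    dFun (fun p => dJ f p (W p)) (par x z) (V (par x z))
      = fderiv ℝ (fun z' => fderiv ℝ (f ∘ par x) z' (0, (rep x W z').1)) z (rep x V z) := by
  rw [dFun_rep h (fun p => dJ f p (W p)) V]
  have h1 : (fun p => dJ f p (W p)) ∘ par x =ᶠ[𝓝 z]
      fun z' => fderiv ℝ (f ∘ par x) z' (0, (rep x W z').1) := by
    filter_upwards [eventually_mem_target h] with z' hz'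
    exact dJ_rep hz' f W
  rw [h1.fderiv_eq]

lemma ddJ_par (h : z ∈ (ch x).target) (f : TM n M → ℝ) (V W : VField n M) :
    ddJ f V W (par x z)
      = fderiv ℝ (fun z' => fderiv ℝ (f ∘ par x) z' (0, (rep x W z').1)) z (rep x V z)
        - fderiv ℝ (fun z' => fderiv ℝ (f ∘ par x) z' (0, (rep x V z').1)) z (rep x W z)
        - fderiv ℝ (f ∘ par x) z (0, (rep x (br V W) z).1) := by
  rw [ddJ, dFun_dJ_rep h, dFun_dJ_rep h, dJ_rep h]

/-- The Euler-Lagrange equation in a chart. -/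
lemma euler_lagrange_par (hU : IsOpen U) {L : TM n M → ℝ} (hG : IsGeodesicSpray U L G)
    (hL : ∀ z ∈ chartSet x U, ContDiffAt ℝ ∞ (energy L ∘ par x) z)
    (hh : ∀ z ∈ chartSet x U, fderiv ℝ (energy L ∘ par x) z (0, z.2) = 2 * (energy L ∘ par x) z)
    (hz : z ∈ chartSet x U) {W : VField n M} (hW : VSmooth U W) :
    fderiv ℝ (fderiv ℝ (energy L ∘ par x)) z (z.2, spr x G z) (0, (rep x W z).1)
      = fderiv ℝ (energy L ∘ par x) z ((rep x W z).1, 0) := by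
  have hS := hG.isSemispray hU
  obtain ⟨h, hu⟩ := hz
  set e := energy L ∘ par x with he
  have hWu := hW.at hU hu
  have hGu := hG.smooth.at hU hu
  have hLz := hL z ⟨h, hu⟩
  have dW := ((hWu.rep h).differentiableAt (by simp)).hasFDerivAt
  have dG : HasFDerivAt (rep x G)
      ((ContinuousLinearMap.snd ℝ 𝔼 𝔼).prod (fderiv ℝ (spr x G) z)) z :=
    (hasFDerivAt_snd.prodMk ((hS.contDiffAt_spr h hu).differentiableAt
      (by simp)).hasFDerivAt).congr_of_eventuallyEq (hS.rep_eventuallyEq h hu)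
  have dW1 : HasFDerivAt (fun z' => ((0 : 𝔼), (rep x W z').1))
      ((0 : 𝔼 × 𝔼 →L[ℝ] 𝔼).prod ((ContinuousLinearMap.fst ℝ 𝔼 𝔼).comp (fderiv ℝ (rep x W) z))) z :=
    (hasFDerivAt_const _ _).prodMk (hasFDerivAt_fst.comp z dW)
  have dG1 : HasFDerivAt (fun z' => ((0 : 𝔼), (rep x G z').1))
      ((0 : 𝔼 × 𝔼 →L[ℝ] 𝔼).prod ((ContinuousLinearMap.fst ℝ 𝔼 𝔼).comp
        ((ContinuousLinearMap.snd ℝ 𝔼 𝔼).prod (fderiv ℝ (spr x G) z)))) z :=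
    (hasFDerivAt_const _ _).prodMk (hasFDerivAt_fst.comp z dG)
  have h1 := hG.geodesic W hW _ hu
  rw [ddJ_par h, dFun_rep h, ← he, fderiv_fderiv_apply hLz dW1, fderiv_fderiv_apply hLz dG1,
    rep_br' h hGu hWu, dG.fderiv, hS.rep_eq h hu] at h1
  simp only [ContinuousLinearMap.prod_apply, zero_apply, ContinuousLinearMap.comp_apply,
    ContinuousLinearMap.coe_fst', ContinuousLinearMap.coe_snd', Prod.fst_sub] at h1
  have h2 := hess_vert_of_homog (isOpen_chartSet hU) ⟨h, hu⟩ hLz hh (rep x W z)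
  have h3 := apply_pair (fderiv ℝ e z) (rep x W z).1 (rep x W z).2
  have h4 : ((0 : 𝔼), (fderiv ℝ (rep x W) z (z.2, spr x G z)).1 - (rep x W z).2)
      = ((0 : 𝔼), (fderiv ℝ (rep x W) z (z.2, spr x G z)).1) - ((0 : 𝔼), (rep x W z).2) := by simp
  rw [h4, map_sub] at h1
  linarith

lemma exists_vSmooth_of_slit [T2Space M] (hG : IsSemispray (slit n M) G) (h : z ∈ (ch x).target)
    (hu : par x z ∈ slit n M) (a : 𝔼) : ∃ W, VSmooth (slit n M) W ∧ (rep x W z).1 = a := by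
  obtain ⟨Y, hY, hYs⟩ := exists_basic_field _ (lin x (par x z).proj a)
  have hX : PiSmooth (slit n M) (fun u : TM n M => Y u.proj) := hYs.mono (subset_univ _)
  refine ⟨beta G (fun u => Y u.proj), (beta_spec hG hX).1, ?_⟩
  rw [rep_beta hG hX h hu]
  change linInv x (par x z).proj (Y (par x z).proj) = a
  rw [hY, linInv_lin (par_proj_mem h)]

lemma exists_basic_repP [T2Space M] (h : z ∈ (ch x).target) (a : 𝔼) :
    ∃ Y : (q : M) → TangentSpace (𝓡 n) q, PiSmooth (slit n M) (fun u : TM n M => Y u.proj) ∧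
      repP x (fun u : TM n M => Y u.proj) z = a := by
  obtain ⟨Y, hY, hYs⟩ := exists_basic_field _ (lin x (par x z).proj a)
  refine ⟨Y, hYs.mono (subset_univ _), ?_⟩
  change linInv x (par x z).proj (Y (par x z).proj) = a
  rw [hY, linInv_lin (par_proj_mem h)]

section Finsler

variable {F : TM n M → ℝ}

lemma IsFinsler.contDiffAt_par (hF : IsFinsler F) (hz : z ∈ chartSet x (slit n M)) :
    ContDiffAt ℝ ∞ (F ∘ par x) z :=
  contDiffAt_comp_par hz.1 (hF.smooth.contMDiffAt (isOpen_slit.mem_nhds hz.2))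

lemma IsFinsler.contDiffAt_energy (hF : IsFinsler F) (hz : z ∈ chartSet x (slit n M)) :
    ContDiffAt ℝ ∞ (energy F ∘ par x) z :=
  ((hF.contDiffAt_par hz).pow 2).div_const 2

lemma IsFinsler.homog_par (hF : IsFinsler F) (hz : z ∈ chartSet x (slit n M)) :
    fderiv ℝ (F ∘ par x) z (0, z.2) = F (par x z) := by
  have h1 := (((hF.contDiffAt_par hz).differentiableAt (by simp)).hasFDerivAt).hasLineDerivAt
    ((0 : 𝔼), z.2)
  have h2 : (fun t : ℝ => (F ∘ par x) (z + t • ((0 : 𝔼), z.2))) =ᶠ[𝓝 0]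
      fun t => (1 + t) * F (par x z) := by
    filter_upwards [Ioi_mem_nhds (show (-1 : ℝ) < 0 by norm_num)] with t ht
    have ht' : (0 : ℝ) < 1 + t := by
      have : (-1 : ℝ) < t := ht
      linarith
    rw [← hF.homogeneous (par x z) (1 + t) ht']
    have h3 : z + t • ((0 : 𝔼), z.2) = (z.1, linInv x (par x z).proj ((1 + t) • (par x z).2)) := by
      rw [map_smul, linInv_par hz.1, add_smul, one_smul]
      ext <;> simp
    rw [h3, Function.comp_apply]
    exact congrArg F (fibre_eq_par hz.1 ((1 + t) • (par x z).2)).symm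
  rw [HasLineDerivAt] at h1
  have h4 := h1.congr_of_eventuallyEq h2.symm
  refine h4.unique ?_
  simpa using ((hasDerivAt_id (0 : ℝ)).const_add 1).mul_const (F (par x z))

lemma IsFinsler.metric_eq (hF : IsFinsler F) (hz : z ∈ chartSet x (slit n M))
    (a b : TangentSpace (𝓡 n) (par x z).proj) :
    metric F (par x z) a b = fderiv ℝ (fderiv ℝ (energy F ∘ par x)) z
      (0, linInv x (par x z).proj a) (0, linInv x (par x z).proj b) := by
  rw [metric_par hz.1 (hF.contDiffAt_energy hz), fderiv_fderiv_const (hF.contDiffAt_energy hz)]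

lemma IsFinsler.gF_eq (hF : IsFinsler F) (hz : z ∈ chartSet x (slit n M)) (X Y : PiField n M) :
    gF F X Y (par x z) = fderiv ℝ (fderiv ℝ (energy F ∘ par x)) z
      (0, repP x X z) (0, repP x Y z) :=
  hF.metric_eq hz _ _

lemma IsFinsler.nondeg_par (hF : IsFinsler F) (hz : z ∈ chartSet x (slit n M)) (a : 𝔼)
    (ha : ∀ b, fderiv ℝ (fderiv ℝ (energy F ∘ par x)) z (0, a) (0, b) = 0) : a = 0 := by
  have h1 := hF.nondegenerate _ hz.2 (lin x (par x z).proj a) fun b => by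
    rw [hF.metric_eq hz, linInv_lin (par_proj_mem hz.1)]
    exact ha _
  rw [← linInv_lin (par_proj_mem hz.1) a, h1, map_zero]

lemma IsFinsler.pos (hF : IsFinsler F) (hz : z ∈ chartSet x (slit n M)) : 0 < F (par x z) := by
  refine (hF.nonneg _).lt_of_ne' fun h0 => ?_
  have h1 : IsLocalMin (F ∘ par x) z := by
    refine .of_forall fun z' => ?_
    simp only [Function.comp_apply]
    rw [h0]
    exact hF.nonneg _
  have h2 := h1.fderiv_eq_zero
  refine (mem_slit_par hz.1).1 hz.2 (hF.nondeg_par hz _ fun b => ?_)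
  have h3 := fderiv_fderiv_energy (hF.contDiffAt_par hz) ((0 : 𝔼), b) ((0 : 𝔼), z.2)
  rw [h2, Function.comp_apply, h0, zero_mul, zero_apply, zero_mul, add_zero] at h3
  exact h3

lemma IsFinsler.energySpray [T2Space M] (hF : IsFinsler F)
    (hG : IsGeodesicSpray (slit n M) F G) :
    EnergySpray (chartSet x (slit n M)) (energy F ∘ par x) (spr x G) := by
  have hS := hG.isSemispray isOpen_slit
  have hh : ∀ z ∈ chartSet x (slit n M),
      fderiv ℝ (energy F ∘ par x) z (0, z.2) = 2 * (energy F ∘ par x) z := by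
    intro z hz
    have h1 := fderiv_energy (hF.contDiffAt_par hz) ((0 : 𝔼), z.2)
    rw [hF.homog_par hz] at h1
    refine h1.trans ?_
    simp only [Function.comp_apply, energy]
    ring
  refine ⟨isOpen_chartSet isOpen_slit, fun z hz => hF.contDiffAt_energy hz,
    fun z hz => hS.contDiffAt_spr hz.1 hz.2, hh,
    fun z hz => fderiv_spr_vert_self hS hG.homogeneous hz.1 hz.2, fun z hz a => ?_⟩
  obtain ⟨W, hW, hWa⟩ := exists_vSmooth_of_slit hS hz.1 hz.2 a
  have := euler_lagrange_par isOpen_slit hG (fun z hz => hF.contDiffAt_energy hz) hh hz hW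
  rwa [hWa] at this

end Finsler

end EulerLagrange

section ConcurrentInCharts

variable {U : Set (TM n M)} {G : VField n M} {x : M}
  {z : EuclideanSpace ℝ (Fin n) × EuclideanSpace ℝ (Fin n)}

lemma fderiv_fst_of_eventuallyEq {B : 𝔼 × 𝔼 → 𝔼 × 𝔼} {f : 𝔼 × 𝔼 → 𝔼}
    (hB : DifferentiableAt ℝ B z) (hf : (fun z' => (B z').1) =ᶠ[𝓝 z] f) (w : 𝔼 × 𝔼) :
    (fderiv ℝ B z w).1 = fderiv ℝ f z w := by
  rw [← hf.fderiv_eq, fderiv.fst hB]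
  rfl

lemma fderiv_snd_of_eventuallyEq {B : 𝔼 × 𝔼 → 𝔼 × 𝔼} {f : 𝔼 × 𝔼 → 𝔼}
    (hB : DifferentiableAt ℝ B z) (hf : (fun z' => (B z').2) =ᶠ[𝓝 z] f) (w : 𝔼 × 𝔼) :
    (fderiv ℝ B z w).2 = fderiv ℝ f z w := by
  rw [← hf.fderiv_eq, fderiv.snd hB]
  rfl

section Connection

variable {X Y : PiField n M}

lemma rep_gamF_eventuallyEq (h : z ∈ (ch x).target) (X : PiField n M) :
    rep x (gamF X) =ᶠ[𝓝 z] fun z' => (0, repP x X z') := by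
  filter_upwards [eventually_mem_target h] with z' hz'
  exact rep_gamF hz' X

lemma rep_beta_eventuallyEq (hG : IsSemispray (slit n M) G) (hY : PiSmooth (slit n M) Y)
    (hz : z ∈ chartSet x (slit n M)) : rep x (beta G Y) =ᶠ[𝓝 z]
      fun z' => (repP x Y z', (1 / 2 : ℝ) • fderiv ℝ (spr x G) z' (0, repP x Y z')) := by
  filter_upwards [eventually_par_mem isOpen_slit hz.1 hz.2] with z' hz'
  exact rep_beta hG hY hz'.1 hz'.2

/-- The horizontal component of `[β Y, γ X]`. -/
lemma rep_br_beta_gamF_fst (hG : IsSemispray (slit n M) G) (hX : PiSmooth (slit n M) X)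
    (hY : PiSmooth (slit n M) Y) (hz : z ∈ chartSet x (slit n M)) :
    (rep x (br (beta G Y) (gamF X)) z).1 = - fderiv ℝ (repP x Y) z (0, repP x X z) := by
  have h1 := (beta_spec hG hY).1.at isOpen_slit hz.2
  have h2 := (hX.at isOpen_slit hz.2).gamF hz.1
  rw [rep_br' hz.1 h1 h2, Prod.fst_sub,
    fderiv_fst_of_eventuallyEq ((h2.rep hz.1).differentiableAt (by simp))
      (f := fun _ => (0 : 𝔼)) ((rep_gamF_eventuallyEq hz.1 X).fun_comp Prod.fst),
    fderiv_fst_of_eventuallyEq ((h1.rep hz.1).differentiableAt (by simp))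
      (f := repP x Y) ((rep_beta_eventuallyEq hG hY hz).fun_comp Prod.fst), rep_gamF hz.1]
  simp

/-- The horizontal component of `[γ X, β Y]`. -/
lemma rep_br_gamF_beta_fst (hG : IsSemispray (slit n M) G) (hX : PiSmooth (slit n M) X)
    (hY : PiSmooth (slit n M) Y) (hz : z ∈ chartSet x (slit n M)) :
    (rep x (br (gamF X) (beta G Y)) z).1 = fderiv ℝ (repP x Y) z (0, repP x X z) := by
  have h1 := (beta_spec hG hY).1.at isOpen_slit hz.2
  have h2 := (hX.at isOpen_slit hz.2).gamF hz.1
  rw [rep_br' hz.1 h2 h1, Prod.fst_sub,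
    fderiv_fst_of_eventuallyEq ((h2.rep hz.1).differentiableAt (by simp))
      (f := fun _ => (0 : 𝔼)) ((rep_gamF_eventuallyEq hz.1 X).fun_comp Prod.fst),
    fderiv_fst_of_eventuallyEq ((h1.rep hz.1).differentiableAt (by simp))
      (f := repP x Y) ((rep_beta_eventuallyEq hG hY hz).fun_comp Prod.fst), rep_gamF hz.1]
  simp

/-- The vertical component of `[β Y, γ X]`. -/
lemma rep_br_beta_gamF_snd (hG : IsSemispray (slit n M) G) (hX : PiSmooth (slit n M) X)
    (hY : PiSmooth (slit n M) Y) (hz : z ∈ chartSet x (slit n M)) :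
    (rep x (br (beta G Y) (gamF X)) z).2
      = fderiv ℝ (repP x X) z (repP x Y z, (1 / 2 : ℝ) • fderiv ℝ (spr x G) z (0, repP x Y z))
        - (1 / 2 : ℝ) • (fderiv ℝ (fderiv ℝ (spr x G)) z (0, repP x X z) (0, repP x Y z)
          + fderiv ℝ (spr x G) z (0, fderiv ℝ (repP x Y) z (0, repP x X z))) := by
  have h1 := (beta_spec hG hY).1.at isOpen_slit hz.2
  have h2 := (hX.at isOpen_slit hz.2).gamF hz.1
  have hs := hG.contDiffAt_spr hz.1 hz.2
  have hYr := (hY.at isOpen_slit hz.2).repP hz.1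
  have h3 : DifferentiableAt ℝ (fun z' => fderiv ℝ (spr x G) z' (0, repP x Y z')) z :=
    ((hs.fderiv_right (m := ∞) (by simp)).clm_apply
      (contDiffAt_const.prodMk hYr)).differentiableAt (by simp)
  rw [rep_br' hz.1 h1 h2, Prod.snd_sub,
    fderiv_snd_of_eventuallyEq ((h2.rep hz.1).differentiableAt (by simp))
      (f := repP x X) ((rep_gamF_eventuallyEq hz.1 X).fun_comp Prod.snd),
    fderiv_snd_of_eventuallyEq ((h1.rep hz.1).differentiableAt (by simp))
      (f := fun z' => (1 / 2 : ℝ) • fderiv ℝ (spr x G) z' (0, repP x Y z'))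
      ((rep_beta_eventuallyEq hG hY hz).fun_comp Prod.snd), rep_gamF hz.1, rep_beta hG hY hz.1 hz.2,
    fderiv_fun_const_smul h3, smul_apply,
    fderiv_fderiv_apply hs (hasFDerivAt_zero_prodMk hYr)]
  rfl

lemma repP_berwaldV (hG : IsSemispray (slit n M) G) (hX : PiSmooth (slit n M) X)
    (hY : PiSmooth (slit n M) Y) (hz : z ∈ chartSet x (slit n M)) :
    repP x (berwaldV G X Y) z = fderiv ℝ (repP x Y) z (0, repP x X z) := by
  rw [← rep_br_gamF_beta_fst hG hX hY hz, ← repP_rhoF hz.1]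
  rfl

lemma gam_injective (h : z ∈ (ch x).target) : Function.Injective (gam (n := n) (par x z)) := by
  intro a b hab
  rw [gam_par h, gam_par h] at hab
  have h1 := congrArg Prod.snd ((isInvertible_dpar h).injective hab)
  rw [← lin_linInv (par_proj_mem h) a, ← lin_linInv (par_proj_mem h) b]
  exact congrArg _ h1

lemma repP_berwaldH (hG : IsSemispray (slit n M) G) (hX : PiSmooth (slit n M) X)
    (hY : PiSmooth (slit n M) Y) (hz : z ∈ chartSet x (slit n M)) :
    repP x (berwaldH G Y X) z = (rep x (br (beta G Y) (gamF X)) z).2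
      - (1 / 2 : ℝ) • fderiv ℝ (spr x G) z (0, (rep x (br (beta G Y) (gamF X)) z).1) := by
  have h1 := (beta_spec hG hY).1.at isOpen_slit hz.2
  have h2 := (hX.at isOpen_slit hz.2).gamF hz.1
  have h3 := rep_vProj hG hz.1 hz.2 (h1.br h2)
  set c := (rep x (br (beta G Y) (gamF X)) z).2
      - (1 / 2 : ℝ) • fderiv ℝ (spr x G) z (0, (rep x (br (beta G Y) (gamF X)) z).1) with hc
  rw [rep_eq_iff hz.1] at h3
  have h4 : berwaldH G Y X (par x z) = lin x (par x z).proj c := by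
    rw [berwaldH, h3]
    have h5 := gam_par hz.1 (lin x (par x z).proj c)
    rw [linInv_lin (par_proj_mem hz.1)] at h5
    rw [← h5]
    exact Function.leftInverse_invFun (gam_injective hz.1) _
  rw [repP, h4, linInv_lin (par_proj_mem hz.1)]

end Connection

section Concurrent

variable {F : TM n M → ℝ} {φ : PiField n M}

lemma repP_neg (X : PiField n M) : repP x (fun u => - X u) z = - repP x X z :=
  map_neg _ _

lemma repP_zero : repP x (fun _ => 0 : PiField n M) z = 0 :=
  map_zero _

lemma repP_congr {X Y : PiField n M} (h : X (par x z) = Y (par x z)) :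
    repP x X z = repP x Y z := by
  rw [repP, repP, h]

variable [T2Space M]

/-- A concurrent `π`-vector field in a chart, without the condition from the Cartan connection. -/
lemma IsConcurrent.flatConcurrent (hF : IsFinsler F) (hG : IsGeodesicSpray (slit n M) F G)
    (hφ : IsConcurrent F G φ) : FlatConcurrent (chartSet x (slit n M)) (energy F ∘ par x)
      (spr x G) (repP x φ) (Phi F φ ∘ par x) := by
  have hS := hG.isSemispray isOpen_slit
  have hE := hF.energySpray (x := x) hG
  have hv : ∀ z ∈ chartSet x (slit n M), ∀ a, fderiv ℝ (repP x φ) z (0, a) = 0 := by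
    intro z hz a
    obtain ⟨Y, hY, rfl⟩ := exists_basic_repP hz.1 a
    rw [← repP_berwaldV hS hY hφ.smooth hz, ← repP_zero (x := x) (z := z)]
    exact repP_congr (hφ.berwald_v _ hY _ hz.2)
  refine ⟨hE, fun z hz => (hφ.smooth.at isOpen_slit hz.2).repP hz.1, fun z hz => ?_, hv,
    fun z hz a => ?_⟩
  · have h1 := hF.gF_eq hz φ eta
    rw [repP_eta hz.1] at h1
    have h2 := hE.hess_vert hz (0, repP x φ z)
    change gF F φ eta (par x z) = _
    rw [h1]
    simp only at h2
    linarith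
  · obtain ⟨Y, hY, rfl⟩ := exists_basic_repP hz.1 a
    have h1 := repP_berwaldH hS hφ.smooth hY hz
    have h2 : repP x (berwaldH G (fun u => Y u.proj) φ) z
        = repP x (fun u : TM n M => - Y u.proj) z := repP_congr (hφ.berwald_h _ hY _ hz.2)
    have h3 := fderiv_repP_basic Y
      (((hY.at isOpen_slit hz.2).repP hz.1).differentiableAt (by simp)) (repP x φ z)
    rw [h2, repP_neg, rep_br_beta_gamF_snd hS hφ.smooth hY hz,
      rep_br_beta_gamF_fst hS hφ.smooth hY hz, h3] at h1
    simp only [neg_zero, Prod.mk_zero_zero, map_zero, add_zero, smul_zero, sub_zero] at h1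
    exact h1.symm

lemma IsConcurrent.flatFinsler (hF : IsFinsler F) (hG : IsGeodesicSpray (slit n M) F G)
    (hφ : IsConcurrent F G φ) : FlatFinsler (chartSet x (slit n M)) (F ∘ par x)
      (spr x G) (repP x φ) (Phi F φ ∘ par x) := by
  have hS := hG.isSemispray isOpen_slit
  have hC := hφ.flatConcurrent (x := x) hF hG
  refine ⟨hC, fun z hz => hF.contDiffAt_par hz, fun z hz a c => ?_, fun z hz => hF.pos hz,
    fun z hz => hF.nondeg_par hz⟩
  obtain ⟨X, hX, rfl⟩ := exists_basic_repP hz.1 c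
  obtain ⟨Z, hZ, rfl⟩ := exists_basic_repP hz.1 a
  have dZ := ((hZ.at isOpen_slit hz.2).repP hz.1)
  have h1 := hφ.cartan_v _ hX _ hZ _ hz.2
  have h2 := fderiv_repP_basic Z (dZ.differentiableAt (by simp))
  rw [hF.gF_eq hz, hF.gF_eq hz, hF.gF_eq hz, repP_rhoF hz.1, repP_rhoF hz.1,
    rep_br_beta_gamF_fst hS hX hZ hz, rep_br_gamF_beta_fst hS hX hφ.smooth hz, h2,
    hC.vert_p z hz, repP_zero, dFun_rep hz.1, rep_gamF hz.1] at h1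
  have h3 : gF F φ (fun u => Z u.proj) ∘ par x =ᶠ[𝓝 z]
      fun z' => fderiv ℝ (Phi F φ ∘ par x) z' (0, repP x (fun u : TM n M => Z u.proj) z') := by
    filter_upwards [(isOpen_chartSet isOpen_slit).mem_nhds hz] with z' hz'
    rw [hC.fderiv_Phi_vert hz', Function.comp_apply, hF.gF_eq hz',
      fderiv_fderiv_symm (hF.contDiffAt_energy hz')]
  rw [h3.fderiv_eq, fderiv_fderiv_apply (hC.smooth_Phi hz) (hasFDerivAt_zero_prodMk dZ)] at h1
  simp only [ContinuousLinearMap.prod_apply, h2, neg_zero, Prod.mk_zero_zero, map_zero, zero_apply,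
    add_zero, mul_zero] at h1
  exact h1.symm

lemma IsConcurrent.pSq_par (hF : IsFinsler F) (hG : IsGeodesicSpray (slit n M) F G)
    (hφ : IsConcurrent F G φ) (hz : z ∈ chartSet x (slit n M)) :
    pSq F φ (par x z) = fderiv ℝ (Phi F φ ∘ par x) z (0, repP x φ z) := by
  rw [(hφ.flatConcurrent hF hG).fderiv_Phi_vert hz]
  exact hF.gF_eq hz φ φ

lemma IsConcurrent.Delta_par (hF : IsFinsler F) (hG : IsGeodesicSpray (slit n M) F G)
    (hφ : IsConcurrent F G φ) (hz : z ∈ chartSet x (slit n M)) :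
    Delta F φ (par x z) = flatDelta (F ∘ par x) (Phi F φ ∘ par x) (repP x φ) z := by
  rw [Delta, hφ.pSq_par hF hG hz]
  rfl

lemma IsConcurrent.f₁_par (hF : IsFinsler F) (hG : IsGeodesicSpray (slit n M) F G)
    (hφ : IsConcurrent F G φ) (hz : z ∈ chartSet x (slit n M)) :
    f₁ F φ (par x z) = flatf₁ (F ∘ par x) (Phi F φ ∘ par x) (repP x φ) z := by
  rw [f₁, hφ.Delta_par hF hG hz]
  rfl

lemma IsConcurrent.f₂_par (hF : IsFinsler F) (hG : IsGeodesicSpray (slit n M) F G)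
    (hφ : IsConcurrent F G φ) (hz : z ∈ chartSet x (slit n M)) :
    f₂ F φ (par x z) = flatf₂ (F ∘ par x) (Phi F φ ∘ par x) (repP x φ) z := by
  rw [f₂, hφ.Delta_par hF hG hz]
  rfl

end Concurrent

end ConcurrentInCharts

section MatsumotoChange

variable {U : Set (TM n M)} {G : VField n M} {x : M}
  {z : EuclideanSpace ℝ (Fin n) × EuclideanSpace ℝ (Fin n)}

lemma VSmooth.of_forall {V : VField n M} (h : ∀ u ∈ U, VSmoothAt V u) : VSmooth U V :=
  fun u hu => ContMDiffAt.contMDiffWithinAt (h u hu)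

lemma VSmooth.br (hU : IsOpen U) {V W : VField n M} (hV : VSmooth U V) (hW : VSmooth U W) :
    VSmooth U (br V W) :=
  .of_forall fun _ hu => (hV.at hU hu).br (hW.at hU hu)

lemma VSmooth.congr {V W : VField n M} (hV : VSmooth U V) (h : EqOn W V U) : VSmooth U W :=
  ContMDiffOn.congr hV fun u hu => by rw [h hu]

lemma VSmooth.mono {U' : Set (TM n M)} {V : VField n M} (hV : VSmooth U V) (h : U' ⊆ U) :
    VSmooth U' V :=
  ContMDiffOn.mono hV h

lemma IsSemispray.mono {U' : Set (TM n M)} (hG : IsSemispray U G) (hU' : IsOpen U')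
    (h : U' ⊆ U) : IsSemispray U' G :=
  ⟨hU', hG.smooth.mono h, fun u hu => hG.J_eq u (h hu)⟩

section Bracket

lemma br_congr (hU : IsOpen U) {V V' W W' : VField n M} (hV : EqOn V V' U) (hW : EqOn W W' U) :
    EqOn (br V W) (br V' W') U := fun _ hu =>
  (hV.eventuallyEq_of_mem (hU.mem_nhds hu)).mlieBracket_vectorField_eq
    (hW.eventuallyEq_of_mem (hU.mem_nhds hu))

lemma br_add_left (hU : IsOpen U) {V V' W : VField n M} (hV : VSmooth U V)
    (hV' : VSmooth U V') : EqOn (br (V + V') W) (br V W + br V' W) U := fun _ hu =>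
  mlieBracket_add_left (hV.at hU hu).mdiff (hV'.at hU hu).mdiff

lemma br_add_right (hU : IsOpen U) {V W W' : VField n M} (hW : VSmooth U W)
    (hW' : VSmooth U W') : EqOn (br V (W + W')) (br V W + br V W') U := fun _ hu =>
  mlieBracket_add_right (hW.at hU hu).mdiff (hW'.at hU hu).mdiff

/-- Operators on vector fields which on `U` are smooth, additive and local, such as the action of
a smooth vector `1`-form. -/
structure IsLocalAdditive (U : Set (TM n M)) (K : VField n M → VField n M) : Prop where
  smooth : ∀ W, VSmooth U W → VSmooth U (K W)
  add : ∀ V W, VSmooth U V → VSmooth U W → EqOn (K (V + W)) (K V + K W) U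
  congr : ∀ V W, VSmooth U V → VSmooth U W → EqOn V W U → EqOn (K V) (K W) U

variable {K K' S : VField n M → VField n M}

lemma IsLocalAdditive.apply_add (hK : IsLocalAdditive U K) {V V₁ V₂ : VField n M}
    (hV : VSmooth U V) (hV₁ : VSmooth U V₁) (hV₂ : VSmooth U V₂) (h : EqOn V (V₁ + V₂) U)
    {u : TM n M} (hu : u ∈ U) : K V u = K V₁ u + K V₂ u :=
  (hK.congr _ _ hV (hV.congr h.symm) h hu).trans (hK.add _ _ hV₁ hV₂ hu)

/-- The expansion of `[K + S, K + S]`. -/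
lemma fnBracket_add_self (hU : IsOpen U) (hK : IsLocalAdditive U K) (hS : IsLocalAdditive U S)
    (hK' : IsLocalAdditive U K') (h : ∀ W, VSmooth U W → EqOn (K' W) (K W + S W) U)
    {W Z : VField n M} (hW : VSmooth U W) (hZ : VSmooth U Z) {u : TM n M} (hu : u ∈ U) :
    fnBracket K' K' W Z u
      = fnBracket K K W Z u + (2 : ℝ) • fnBracket K S W Z u + fnBracket S S W Z u := by
  have kW := hK.smooth W hW
  have kZ := hK.smooth Z hZ
  have sW := hS.smooth W hW
  have sZ := hS.smooth Z hZ
  have b1 : EqOn (br (K' W) Z) (br (K W) Z + br (S W) Z) U :=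
    (br_congr hU (h W hW) (eqOn_refl Z U)).trans (br_add_left hU kW sW)
  have b2 : EqOn (br W (K' Z)) (br W (K Z) + br W (S Z)) U :=
    (br_congr hU (eqOn_refl W U) (h Z hZ)).trans (br_add_right hU kZ sZ)
  have b3 : br (K' W) (K' Z) u
      = (br (K W) (K Z) u + br (K W) (S Z) u) + (br (S W) (K Z) u + br (S W) (S Z) u) := by
    have e1 := br_congr hU (h W hW) (h Z hZ) hu
    have e2 : br (K W + S W) (K Z + S Z) u = br (K W) (K Z + S Z) u + br (S W) (K Z + S Z) u :=
      br_add_left hU kW sW hu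
    have e3 : br (K W) (K Z + S Z) u = br (K W) (K Z) u + br (K W) (S Z) u :=
      br_add_right hU kZ sZ hu
    have e4 : br (S W) (K Z + S Z) u = br (S W) (K Z) u + br (S W) (S Z) u :=
      br_add_right hU kZ sZ hu
    rw [e1, e2, e3, e4]
  have key : ∀ V V₁ V₂, VSmooth U V → VSmooth U V₁ → VSmooth U V₂ → EqOn V (V₁ + V₂) U →
      K' V u = (K V₁ u + K V₂ u) + (S V₁ u + S V₂ u) := by
    intro V V₁ V₂ hV hV₁ hV₂ hVV
    have e1 : K' V u = K V u + S V u := h V hV hu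
    rw [e1, hK.apply_add hV hV₁ hV₂ hVV hu, hS.apply_add hV hV₁ hV₂ hVV hu]
  have hWZ := hW.br hU hZ
  have k1 := key _ _ _ ((hK'.smooth W hW).br hU hZ) (kW.br hU hZ) (sW.br hU hZ) b1
  have k2 := key _ _ _ (hW.br hU (hK'.smooth Z hZ)) (hW.br hU kZ) (hW.br hU sZ) b2
  have k3 := key _ _ _ (hK'.smooth _ hWZ) (hK.smooth _ hWZ) (hS.smooth _ hWZ) (h _ hWZ)
  simp only [fnBracket]
  rw [k1, k2, k3, b3]
  module

lemma IsSemispray.isLocalAdditive_hProj (hG : IsSemispray U G) :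
    IsLocalAdditive U (hProj G) := by
  refine ⟨fun W hW => .of_forall fun u hu => ?_, fun V W hV hW u hu => ?_,
    fun V W hV hW hVW u hu => ?_⟩
  · obtain ⟨x, z, h, rfl⟩ := exists_par u
    exact vSmoothAt_hProj hG h hu hW
  · obtain ⟨x, z, h, rfl⟩ := exists_par u
    have hV' := hV.at hG.isOpen hu
    have hW' := hW.at hG.isOpen hu
    have e : rep x (V + W) z = rep x V z + rep x W z := rep_add V W
    have hVW : VSmoothAt (V + W) (par x z) :=
      VSmoothAt_of_rep h (((hV'.rep h).add (hW'.rep h)).congr_of_eventuallyEq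
        (.of_forall fun _ => rep_add V W))
    refine rep_inj h (V := hProj G (V + W)) (W := hProj G V + hProj G W) ?_
    have e1 : rep x (hProj G V + hProj G W) z = rep x (hProj G V) z + rep x (hProj G W) z :=
      rep_add _ _
    rw [e1, rep_hProj hG h hu hVW, rep_hProj hG h hu hV', rep_hProj hG h hu hW', e]
    refine Prod.ext rfl ?_
    have e2 : ((0 : 𝔼), (rep x V z + rep x W z).1)
        = ((0 : 𝔼), (rep x V z).1) + ((0 : 𝔼), (rep x W z).1) := by simp
    simp only [Prod.snd_add]
    rw [e2, map_add, smul_add]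
  · obtain ⟨x, z, h, rfl⟩ := exists_par u
    refine rep_inj h ?_
    rw [rep_hProj hG h hu (hV.at hG.isOpen hu), rep_hProj hG h hu (hW.at hG.isOpen hu),
      rep_congr (hVW hu)]

end Bracket

section Tensor

lemma J_gam (u : TM n M) (a : TangentSpace (𝓡 n) u.proj) : J u (gam u a) = 0 := by
  obtain ⟨x, z, h, rfl⟩ := exists_par u
  rw [gam_par h, J_par h, Prod.mk_zero_zero, map_zero]

lemma J_J (u : TM n M) (w : TangentSpace (𝓡 n).tangent u) : J u (J u w) = 0 := J_gam u _

variable {F : TM n M → ℝ} {φ : PiField n M}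

lemma SForm_apply (u : TM n M) (w : TangentSpace (𝓡 n).tangent u) :
    SForm F φ u w = -((1 / 2 : ℝ) • (f₁ F φ u • J u w + dJ (f₁ F φ) u w • gam u (eta u)
      - dJ (f₂ F φ) u w • gam u (φ u))) := rfl

lemma SForm_J (u : TM n M) (w : TangentSpace (𝓡 n).tangent u) : SForm F φ u (J u w) = 0 := by
  have h1 : ∀ f : TM n M → ℝ, dJ f u (J u w) = 0 := fun f =>
    (congrArg (dFun f u) (J_J u w)).trans (map_zero _)
  rw [SForm_apply, h1, h1, J_J]
  simp

lemma J_SForm (u : TM n M) (w : TangentSpace (𝓡 n).tangent u) : J u (SForm F φ u w) = 0 := by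
  rw [SForm_apply, map_neg, map_smul, map_sub, map_add, map_smul, map_smul, map_smul, J_J, J_gam,
    J_gam]
  simp

lemma rep_SF (h : z ∈ (ch x).target) (W : VField n M) :
    rep x (SF F φ W) z = (0, -((1 / 2 : ℝ) • (f₁ F φ (par x z) • (rep x W z).1
      + fderiv ℝ (f₁ F φ ∘ par x) z (0, (rep x W z).1) • z.2
      - fderiv ℝ (f₂ F φ ∘ par x) z (0, (rep x W z).1) • repP x φ z))) := by
  rw [rep_eq_iff h]
  have e1 : SF F φ W (par x z) = -((1 / 2 : ℝ) • (f₁ F φ (par x z) • JF W (par x z)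
      + dJ (f₁ F φ) (par x z) (W (par x z)) • liouville (par x z)
      - dJ (f₂ F φ) (par x z) (W (par x z)) • gamF φ (par x z))) := rfl
  rw [e1, dJ_rep h, dJ_rep h, ← dpar_rep h (JF W), ← dpar_rep h liouville, ← dpar_rep h (gamF φ),
    rep_JF h, rep_liouville h, rep_gamF h, ← map_smul, ← map_smul, ← map_smul, ← map_add,
    ← map_sub, ← map_smul, ← map_neg]
  simp

lemma SF_add (V W : VField n M) (u : TM n M) :
    SF F φ (V + W) u = SF F φ V u + SF F φ W u :=
  map_add (SForm F φ u) _ _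

end Tensor

section Matsumoto

variable {F : TM n M → ℝ} {φ : PiField n M} {G' : VField n M}

lemma conicDomain_subset : conicDomain F φ ⊆ slit n M := fun _ hu => hu.1

lemma chartSet_conicDomain_subset :
    chartSet x (conicDomain F φ) ⊆ chartSet x (slit n M) := fun _ hz => ⟨hz.1, hz.2.1⟩

variable [T2Space M]

lemma isOpen_conicDomain (hF : IsFinsler F) (hG : IsGeodesicSpray (slit n M) F G)
    (hφ : IsConcurrent F G φ) : IsOpen (conicDomain F φ) := by
  refine isOpen_of_forall_par fun x z h hu => ?_
  have hz : z ∈ chartSet x (slit n M) := ⟨h, hu.1⟩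
  have hC := hφ.flatConcurrent (x := x) hF hG
  have h1 : ∀ᶠ z' in 𝓝 z, (Phi F φ ∘ par x) z' < (F ∘ par x) z' :=
    (hC.smooth_Phi hz).continuousAt.eventually_lt (hF.contDiffAt_par hz).continuousAt hu.2
  filter_upwards [h1, eventually_par_mem isOpen_slit h hu.1] with z' h2 h3 _
  exact ⟨h3.2, h2⟩

/-- The geodesic spray of `F² / (F - Φ)` in a chart. -/
lemma spr_matsumoto (hF : IsFinsler F) (hG : IsGeodesicSpray (slit n M) F G)
    (hφ : IsConcurrent F G φ) (hΔ : ∀ u ∈ conicDomain F φ, Delta F φ u ≠ 0)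
    (hG' : IsGeodesicSpray (conicDomain F φ) (matsumoto F φ) G')
    (hz : z ∈ chartSet x (conicDomain F φ)) :
    spr x G' z = spr x G z - f₁ F φ (par x z) • z.2 + f₂ F φ (par x z) • repP x φ z := by
  have hU := isOpen_conicDomain hF hG hφ
  have hS := hG.isSemispray isOpen_slit
  have hS' := hG'.isSemispray hU
  have hC := hφ.flatFinsler (x := x) hF hG
  have hsub := chartSet_conicDomain_subset (x := x) (F := F) (φ := φ)
  have hL : ∀ z ∈ chartSet x (conicDomain F φ),
      ContDiffAt ℝ ∞ (energy (matsumoto F φ) ∘ par x) z := by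
    intro z hz
    have sF := hC.smooth_F z (hsub hz)
    exact (((sF.pow 2).div (sF.sub (hC.smooth_Phi (hsub hz)))
      (sub_pos.2 hz.2.2).ne').pow 2).div_const 2
  have hE : energy (matsumoto F φ) ∘ par x = fun z => ((F ∘ par x) z ^ 2
      / ((F ∘ par x) z - (Phi F φ ∘ par x) z)) ^ 2 / 2 := rfl
  have hh : ∀ z ∈ chartSet x (conicDomain F φ),
      fderiv ℝ (energy (matsumoto F φ) ∘ par x) z (0, z.2)
        = 2 * (energy (matsumoto F φ) ∘ par x) z := by
    intro z hz
    have hq0 : (F ∘ par x) z - (Phi F φ ∘ par x) z ≠ 0 := (sub_pos.2 hz.2.2).ne'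
    rw [hE, fderiv_matsumoto_energy ((hC.smooth_F z (hsub hz)).differentiableAt (by simp))
      ((hC.smooth_Phi (hsub hz)).differentiableAt (by simp)) hz.2.2, hC.homog_F (hsub hz),
      hC.homog_Phi (hsub hz)]
    field_simp
    ring
  rw [hφ.f₁_par hF hG (hsub hz), hφ.f₂_par hF hG (hsub hz)]
  refine hC.spray_eq (isOpen_chartSet hU) hsub (fun z hz => hz.2.2)
    (fun z hz => hφ.Delta_par hF hG (hsub hz) ▸ hΔ _ hz.2)
    (fun z hz => (hS'.contDiffAt_spr hz.1 hz.2).continuousAt) (fun z hz a => ?_) hz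
  obtain ⟨W, hW, rfl⟩ := exists_vSmooth_of_slit hS hz.1 hz.2.1 a
  rw [← hE, fderiv_fderiv_const (hL z hz)]
  exact euler_lagrange_par hU hG' hL hh hz (hW.mono conicDomain_subset)

lemma fderiv_spr_matsumoto (hF : IsFinsler F) (hG : IsGeodesicSpray (slit n M) F G)
    (hφ : IsConcurrent F G φ) (hΔ : ∀ u ∈ conicDomain F φ, Delta F φ u ≠ 0)
    (hG' : IsGeodesicSpray (conicDomain F φ) (matsumoto F φ) G')
    (hz : z ∈ chartSet x (conicDomain F φ)) (a : 𝔼) :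
    fderiv ℝ (spr x G') z (0, a) = fderiv ℝ (spr x G) z (0, a)
      - (f₁ F φ (par x z) • a + fderiv ℝ (f₁ F φ ∘ par x) z (0, a) • z.2)
      + fderiv ℝ (f₂ F φ ∘ par x) z (0, a) • repP x φ z := by
  have hU := isOpen_conicDomain hF hG hφ
  have hsub := chartSet_conicDomain_subset (x := x) (F := F) (φ := φ)
  have hC := hφ.flatFinsler (x := x) hF hG
  have hΔz : flatDelta (F ∘ par x) (Phi F φ ∘ par x) (repP x φ) z ≠ 0 :=
    hφ.Delta_par hF hG (hsub hz) ▸ hΔ _ hz.2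
  have hn := (isOpen_chartSet (x := x) (isOpen_slit (n := n) (M := M))).mem_nhds (hsub hz)
  have d1 : HasFDerivAt (f₁ F φ ∘ par x) (fderiv ℝ (f₁ F φ ∘ par x) z) z := by
    refine DifferentiableAt.hasFDerivAt (ContDiffAt.differentiableAt (n := ∞) ?_ (by simp))
    refine (hC.contDiffAt_flatf₁ (hsub hz) hΔz).congr_of_eventuallyEq ?_
    filter_upwards [hn] with z' hz' using hφ.f₁_par hF hG hz'
  have d2 : HasFDerivAt (f₂ F φ ∘ par x) (fderiv ℝ (f₂ F φ ∘ par x) z) z := by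
    refine DifferentiableAt.hasFDerivAt (ContDiffAt.differentiableAt (n := ∞) ?_ (by simp))
    refine (hC.contDiffAt_flatf₂ (hsub hz) hΔz).congr_of_eventuallyEq ?_
    filter_upwards [hn] with z' hz' using hφ.f₂_par hF hG hz'
  have dp := ((hC.smooth_p z (hsub hz)).differentiableAt (by simp)).hasFDerivAt
  have ds := ((hC.smooth_s z (hsub hz)).differentiableAt (by simp)).hasFDerivAt
  have h1 : spr x G' =ᶠ[𝓝 z] spr x G - f₁ F φ ∘ par x • Prod.snd
      + f₂ F φ ∘ par x • repP x φ := by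
    filter_upwards [(isOpen_chartSet hU).mem_nhds hz] with z' hz'
    exact spr_matsumoto hF hG hφ hΔ hG' hz'
  rw [h1.fderiv_eq, ((ds.sub (d1.smul hasFDerivAt_snd)).add (d2.smul dp)).fderiv]
  simp [hC.vert_p z (hsub hz)]

lemma rep_hProj_matsumoto (hF : IsFinsler F) (hG : IsGeodesicSpray (slit n M) F G)
    (hφ : IsConcurrent F G φ) (hΔ : ∀ u ∈ conicDomain F φ, Delta F φ u ≠ 0)
    (hG' : IsGeodesicSpray (conicDomain F φ) (matsumoto F φ) G') {W : VField n M}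
    (hW : VSmooth (conicDomain F φ) W) (hz : z ∈ chartSet x (conicDomain F φ)) :
    rep x (hProj G' W) z = rep x (hProj G W) z + rep x (SF F φ W) z := by
  have hU := isOpen_conicDomain hF hG hφ
  have hW' := hW.at hU hz.2
  rw [rep_hProj (hG'.isSemispray hU) hz.1 hz.2 hW',
    rep_hProj (hG.isSemispray isOpen_slit) hz.1 hz.2.1 hW', rep_SF hz.1,
    fderiv_spr_matsumoto hF hG hφ hΔ hG' hz]
  refine Prod.ext (add_zero _).symm ?_
  simp only [Prod.snd_add]
  module

lemma rep_vProj_matsumoto (hF : IsFinsler F) (hG : IsGeodesicSpray (slit n M) F G)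
    (hφ : IsConcurrent F G φ) (hΔ : ∀ u ∈ conicDomain F φ, Delta F φ u ≠ 0)
    (hG' : IsGeodesicSpray (conicDomain F φ) (matsumoto F φ) G') {W : VField n M}
    (hW : VSmooth (conicDomain F φ) W) (hz : z ∈ chartSet x (conicDomain F φ)) :
    rep x (vProj G' W) z = rep x (vProj G W) z - rep x (SF F φ W) z := by
  have hU := isOpen_conicDomain hF hG hφ
  have hW' := hW.at hU hz.2
  rw [rep_vProj (hG'.isSemispray hU) hz.1 hz.2 hW',
    rep_vProj (hG.isSemispray isOpen_slit) hz.1 hz.2.1 hW', rep_SF hz.1,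
    fderiv_spr_matsumoto hF hG hφ hΔ hG' hz]
  refine Prod.ext (sub_zero _).symm ?_
  simp only [Prod.snd_sub]
  module

lemma hProj_matsumoto (hF : IsFinsler F) (hG : IsGeodesicSpray (slit n M) F G)
    (hφ : IsConcurrent F G φ) (hΔ : ∀ u ∈ conicDomain F φ, Delta F φ u ≠ 0)
    (hG' : IsGeodesicSpray (conicDomain F φ) (matsumoto F φ) G') {W : VField n M}
    (hW : VSmooth (conicDomain F φ) W) {u : TM n M} (hu : u ∈ conicDomain F φ) :
    hProj G' W u = hProj G W u + SF F φ W u := by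
  obtain ⟨x, z, h, rfl⟩ := exists_par u
  refine rep_inj h (V := hProj G' W) (W := fun u => hProj G W u + SF F φ W u) ?_
  rw [rep_hProj_matsumoto hF hG hφ hΔ hG' hW ⟨h, hu⟩]
  exact (rep_add _ _).symm

lemma vProj_matsumoto (hF : IsFinsler F) (hG : IsGeodesicSpray (slit n M) F G)
    (hφ : IsConcurrent F G φ) (hΔ : ∀ u ∈ conicDomain F φ, Delta F φ u ≠ 0)
    (hG' : IsGeodesicSpray (conicDomain F φ) (matsumoto F φ) G') {W : VField n M}
    (hW : VSmooth (conicDomain F φ) W) {u : TM n M} (hu : u ∈ conicDomain F φ) :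
    vProj G' W u = vProj G W u - SF F φ W u := by
  obtain ⟨x, z, h, rfl⟩ := exists_par u
  refine rep_inj h (V := vProj G' W) (W := fun u => vProj G W u - SF F φ W u) ?_
  rw [rep_vProj_matsumoto hF hG hφ hΔ hG' hW ⟨h, hu⟩]
  exact (rep_sub _ _).symm

lemma isLocalAdditive_SF (hF : IsFinsler F) (hG : IsGeodesicSpray (slit n M) F G)
    (hφ : IsConcurrent F G φ) (hΔ : ∀ u ∈ conicDomain F φ, Delta F φ u ≠ 0)
    (hG' : IsGeodesicSpray (conicDomain F φ) (matsumoto F φ) G') :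
    IsLocalAdditive (conicDomain F φ) (SF F φ) := by
  have hU := isOpen_conicDomain hF hG hφ
  refine ⟨fun W hW => .of_forall fun u hu => ?_, fun V W _ _ u _ => SF_add V W u,
    fun V W _ _ h u hu => congrArg (SForm F φ u) (h hu)⟩
  obtain ⟨x, z, h, rfl⟩ := exists_par u
  have h1 := ((hG'.isSemispray hU).isLocalAdditive_hProj.smooth W hW).at hU hu
  have h2 := (((hG.isSemispray isOpen_slit).mono hU
    conicDomain_subset).isLocalAdditive_hProj.smooth W hW).at hU hu
  refine VSmoothAt_of_rep h (((h1.rep h).sub (h2.rep h)).congr_of_eventuallyEq ?_)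
  filter_upwards [(isOpen_chartSet hU).mem_nhds ⟨h, hu⟩] with z' hz'
  rw [rep_hProj_matsumoto hF hG hφ hΔ hG' hW hz', add_sub_cancel_left]

end Matsumoto

end MatsumotoChange

end

end FinslerGeom

theorem mainTheorem7 {n : ℕ} {M : Type*} [TopologicalSpace M] [T2Space M] [ParacompactSpace M]
    [ChartedSpace (EuclideanSpace ℝ (Fin n)) M] [IsManifold (𝓡 n) ∞ M]
    (F : FinslerGeom.TM n M → ℝ) (hF : FinslerGeom.IsFinsler F)
    (G : FinslerGeom.VField n M)
    (hG : FinslerGeom.IsGeodesicSpray (FinslerGeom.slit n M) F G)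
    (φ : FinslerGeom.PiField n M) (hφ : FinslerGeom.IsConcurrent F G φ)
    (hΔ : ∀ u ∈ FinslerGeom.conicDomain F φ, FinslerGeom.Delta F φ u ≠ 0)
    (G' : FinslerGeom.VField n M)
    (hG' : FinslerGeom.IsGeodesicSpray (FinslerGeom.conicDomain F φ)
      (FinslerGeom.matsumoto F φ) G') :
    FinslerGeom.IsSemibasic (FinslerGeom.conicDomain F φ) (FinslerGeom.SForm F φ) ∧
    (∀ W, FinslerGeom.VSmooth (FinslerGeom.conicDomain F φ) W →
      ∀ u ∈ FinslerGeom.conicDomain F φ,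
        FinslerGeom.hProj G' W u = FinslerGeom.hProj G W u + FinslerGeom.SF F φ W u ∧
        FinslerGeom.vProj G' W u = FinslerGeom.vProj G W u - FinslerGeom.SF F φ W u) ∧
    (∀ W Z, FinslerGeom.VSmooth (FinslerGeom.conicDomain F φ) W →
      FinslerGeom.VSmooth (FinslerGeom.conicDomain F φ) Z →
      ∀ u ∈ FinslerGeom.conicDomain F φ,
        FinslerGeom.curvature G' W Z u =
          FinslerGeom.curvature G W Z u
            - FinslerGeom.fnBracket (FinslerGeom.hProj G) (FinslerGeom.SF F φ) W Z u
            - FinslerGeom.nijenhuis (FinslerGeom.SF F φ) W Z u) := by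
  have hU := FinslerGeom.isOpen_conicDomain hF hG hφ
  have hS := FinslerGeom.isLocalAdditive_SF hF hG hφ hΔ hG'
  refine ⟨⟨hS.smooth, fun u _ => FinslerGeom.SForm_J u, fun u _ => FinslerGeom.J_SForm u⟩,
    fun W hW u hu => ⟨FinslerGeom.hProj_matsumoto hF hG hφ hΔ hG' hW hu,
      FinslerGeom.vProj_matsumoto hF hG hφ hΔ hG' hW hu⟩, fun W Z hW hZ u hu => ?_⟩
  have h1 := FinslerGeom.fnBracket_add_self hU
    ((hG.isSemispray FinslerGeom.isOpen_slit).mono hU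
      FinslerGeom.conicDomain_subset).isLocalAdditive_hProj hS
    (hG'.isSemispray hU).isLocalAdditive_hProj
    (fun W hW u hu => FinslerGeom.hProj_matsumoto hF hG hφ hΔ hG' hW hu) hW hZ hu
  simp only [FinslerGeom.curvature, FinslerGeom.nijenhuis]
  rw [h1]
  module
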